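/- Let $N\ge 0$ be an integer, $\eta\in\mathbb C$ and $\xi_1,\dots,\xi_N\in\mathbb C$. Given a family of $4\times4$ matrices $R(\lambda)\in\operatorname{End}(\mathbb C^2\otimes\mathbb C^2)$ and $K\in\operatorname{End}(\mathbb C^2)$, define on $\mathbb C^2\otimes\mathcal H$, $\mathcal H=(\mathbb C^2)^{\otimes N}$, the monodromy matrix (a $2\times 2$ matrix of operators on $\mathcal H$) $$M^{(K)}(\lambda)=K_0R_{0N}(\lambda-\xi_N)\cdots R_{01}(\lambda-\xi_1)=\begin{pmatrix}A^{(K)}(\lambda)&B^{(K)}(\lambda)\\ C^{(K)}(\lambda)&D^{(K)}(\lambda)\end{pmatrix},\qquad T^{(K)}(\lambda)=A^{(K)}(\lambda)+D^{(K)}(\lambda),$$ and write $A,B,C,D$ for the entries in the case $K=I$. Let $\langle 0|=\bigotimes_{n=1}^N(1,0)$, and let operators act on covectors from the right. A family of operators $X(\lambda)$, $\lambda\in\mathbb C$, on $\mathcal H$ is called diagonalizable with simple spectrum if all the $X(\lambda)$ are diagonalized by one and the same change of basis and, for all $\lambda$ outside a closed discrete subset of $\mathbb C$, the $2^N$ eigenvalues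 of $X(\lambda)$ are pairwise distinct. **(1) Trigonometric case.** Let $$R(\lambda)=\begin{pmatrix}\sinh(\lambda+\eta)&0&0&0\\0&\sinh\lambda&\sinh\eta&0\\0&\sinh\eta&\sinh\lambda&0\\0&0&0&\sinh(\lambda+\eta)\end{pmatrix},\quad K=\begin{pmatrix}0&e^{\alpha}\\e^{-\alpha}&0\end{pmatrix},\quad a(\lambda)=\prod_{n=1}^N\sinh(\lambda-\xi_n+\eta),$$ with $\alpha\in\mathbb C$, and assume $\sinh\eta\ne0$ and $\xi_a\neq\xi_b+r\eta+im\pi$ for all $a\ne b$, $r\in\{-1,0,1\}$, $m\in\mathbb Z$. Then: * $A^{(K)}(\lambda)=e^{\alpha}C(\lambda)$, $B^{(K)}(\lambda)=e^{\alpha}D(\lambda)$, $C^{(K)}(\lambda)=e^{-\alpha}A(\lambda)$, $D^{(K)}(\lambda)=e^{-\alpha}B(\lambda)$ for all $\lambda\in\mathbb C$. * The operators $T^{(K)}(\xi_1),\dots,T^{(K)}(\xi_N)$ commute pairwise, and so do $A^{(K)}(\xi_1),\dots,A^{(K)}(\xi_N)$, so that the products below do not depend on the order of the factors. * The covectors $\underline{\langle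 h_1,\dots,h_N|}=\langle 0|\prod_{n=1}^N\bigl(A^{(K)}(\xi_n)/(i\,a(\xi_n))\bigr)^{h_n}$, $h\in\{0,1\}^N$, form a basis of $\mathcal H^*$ (Sklyanin's basis) and satisfy, for all $\lambda\in\mathbb C$, $$\underline{\langle h_1,\dots,h_N|}\,B^{(K)}(\lambda)=e^{\alpha}\prod_{n=1}^N\sinh(\lambda-\xi_n+h_n\eta)\;\underline{\langle h_1,\dots,h_N|}.$$ * The family $B^{(K)}(\lambda)$ is diagonalizable with simple spectrum. * For $\langle S|=\langle 0|=\bigotimes_{n=1}^N(1,0)$ and all $h\in\{0,1\}^N$, $$\langle S|\prod_{n=1}^N\Bigl(\frac{T^{(K)}(\xi_n)}{i\,a(\xi_n)}\Bigr)^{h_n}=\underline{\langle h_1,\dots,h_N|}.$$ **(2) Rational case.** Let $$R(\lambda)=\begin{pmatrix}\lambda+\eta&0&0&0\\0&\lambda&\eta&0\\0&\eta&\lambda&0\\0&0&0&\lambda+\eta\end{pmatrix},\qquad a(\lambda)=\prod_{n=1}^N(\lambda-\xi_n+\eta),$$ and assume $\eta\neq0$ and $\xi_a\ne\xi_b+r\eta$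 for all $a\neq b$, $r\in\{-1,0,1\}$. (2a) Let $K=\begin{pmatrix}k_{11}&b\\k_{21}&k_{22}\end{pmatrix}$ be a complex matrix with $b\ne0$. Then the $T^{(K)}(\xi_n)$ commute pairwise, and so do the $A^{(K)}(\xi_n)$. The covectors $\underline{\langle h_1,\dots,h_N|}=\langle0|\prod_{n=1}^N\bigl(A^{(K)}(\xi_n)/a(\xi_n)\bigr)^{h_n}$, $h\in\{0,1\}^N$, form a basis of $\mathcal H^*$ and satisfy $\underline{\langle h_1,\dots,h_N|}B^{(K)}(\lambda)=b\prod_{n=1}^N(\lambda-\xi_n+h_n\eta)\,\underline{\langle h_1,\dots,h_N|}$ for all $\lambda\in\mathbb C$. The family $B^{(K)}(\lambda)$ is diagonalizable with simple spectrum. For all $h\in\{0,1\}^N$, $$\langle0|\prod_{n=1}^N\Bigl(\frac{T^{(K)}(\xi_n)}{a(\xi_n)}\Bigr)^{h_n}=\underline{\langle h_1,\dots,h_N|}.$$ (2b) Let $K$ be any complex $2\times2$ matrix that is not a multiple of the identity. Then the $T^{(K)}(\xi_n)$ commute pairwise, and there is an invertible $W$ such that $\bar K=W^{-1}KW$ has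 a non-zero upper right entry $\bar b$. For every such $W$, the operator $\mathcal W=W^{\otimes N}$ is invertible and $T^{(K)}(\lambda)=\mathcal W\,T^{(\bar K)}(\lambda)\,\mathcal W^{-1}$ for all $\lambda\in\mathbb C$. The covectors $\langle0|\prod_{n=1}^N\bigl(A^{(\bar K)}(\xi_n)/a(\xi_n)\bigr)^{h_n}\mathcal W^{-1}$, $h\in\{0,1\}^N$, form a basis of $\mathcal H^*$ and are left eigencovectors of $\mathcal W B^{(\bar K)}(\lambda)\mathcal W^{-1}$ with eigenvalues $\bar b\prod_{n=1}^N(\lambda-\xi_n+h_n\eta)$ for all $\lambda\in\mathbb C$. This operator family is diagonalizable with simple spectrum. For $\langle S|=\langle0|\mathcal W^{-1}$ and all $h\in\{0,1\}^N$, $$\langle S|\prod_{n=1}^N\Bigl(\frac{T^{(K)}(\xi_n)}{a(\xi_n)}\Bigr)^{h_n}=\langle0|\prod_{n=1}^N\Bigl(\frac{A^{(\bar K)}(\xi_n)}{a(\xi_n)}\Bigr)^{h_n}\mathcal W^{-1}.$$ -/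

import Mathlib

open Filter Matrix

namespace SoV

noncomputable section

/-- Index set of the canonical basis of the quantum space `⊗_{n=1}^N ℂ²` of `N` sites. -/
abbrev Conf (N : ℕ) : Type := Fin N → Fin 2

/-- Operators on the quantum space, written as matrices in the canonical basis. -/
abbrev Op (N : ℕ) : Type := Matrix (Conf N) (Conf N) ℂ

/-- Covectors of the quantum space, as rows in the canonical basis; an operator acts on a
covector from the right, by `ᵥ*`. -/
abbrev Cov (N : ℕ) : Type := Conf N → ℂ

/-- A `4 × 4` matrix read as an endomorphism of `ℂ² ⊗ ℂ²`, with the canonical basis in the order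
`e₁ ⊗ e₁, e₁ ⊗ e₂, e₂ ⊗ e₁, e₂ ⊗ e₂`. -/
def onPair (X : Matrix (Fin 4) (Fin 4) ℂ) : Matrix (Fin 2 × Fin 2) (Fin 2 × Fin 2) ℂ :=
  X.submatrix finProdFinEquiv finProdFinEquiv

/-- The rational six-vertex `R`-matrix. -/
def rationalR (η u : ℂ) : Matrix (Fin 2 × Fin 2) (Fin 2 × Fin 2) ℂ :=
  onPair !![u + η, 0, 0, 0;
            0, u, η, 0;
            0, η, u, 0;
            0, 0, 0, u + η]

/-- The trigonometric six-vertex `R`-matrix. -/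
def trigR (η u : ℂ) : Matrix (Fin 2 × Fin 2) (Fin 2 × Fin 2) ℂ :=
  onPair !![Complex.sinh (u + η), 0, 0, 0;
            0, Complex.sinh u, Complex.sinh η, 0;
            0, Complex.sinh η, Complex.sinh u, 0;
            0, 0, 0, Complex.sinh (u + η)]

/-- The operator that acts as `X` on the `n`-th tensor factor and as the identity elsewhere. -/
def siteOp {N : ℕ} (n : Fin N) (X : Matrix (Fin 2) (Fin 2) ℂ) : Op N :=
  Matrix.of fun s t => if ∀ m, m ≠ n → s m = t m then X (s n) (t n) else 0

/-- The operator `R_{0,n}` on (auxiliary space `ℂ²`) `⊗` (quantum space), written as a `2 × 2`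
matrix in the auxiliary space with entries in the operators on the quantum space. -/
def laxOp {N : ℕ} (R : Matrix (Fin 2 × Fin 2) (Fin 2 × Fin 2) ℂ) (n : Fin N) :
    Matrix (Fin 2) (Fin 2) (Op N) :=
  Matrix.of fun i j => siteOp n (Matrix.of fun p q => R (i, p) (j, q))

/-- The monodromy matrix `K_0 R_{0,N}(u - ξ_N) ⋯ R_{0,1}(u - ξ_1)`. -/
def monodromy {N : ℕ} (R : ℂ → Matrix (Fin 2 × Fin 2) (Fin 2 × Fin 2) ℂ)
    (K : Matrix (Fin 2) (Fin 2) ℂ) (ξ : Fin N → ℂ) (u : ℂ) : Matrix (Fin 2) (Fin 2) (Op N) :=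
  K.map (algebraMap ℂ (Op N)) * (List.ofFn fun n => laxOp (R (u - ξ n)) n).reverse.prod

/-- The entry `A^{(K)}(u)` of the monodromy matrix. -/
def opA {N : ℕ} (R : ℂ → Matrix (Fin 2 × Fin 2) (Fin 2 × Fin 2) ℂ)
    (K : Matrix (Fin 2) (Fin 2) ℂ) (ξ : Fin N → ℂ) (u : ℂ) : Op N := monodromy R K ξ u 0 0

/-- The entry `B^{(K)}(u)` of the monodromy matrix. -/
def opB {N : ℕ} (R : ℂ → Matrix (Fin 2 × Fin 2) (Fin 2 × Fin 2) ℂ)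
    (K : Matrix (Fin 2) (Fin 2) ℂ) (ξ : Fin N → ℂ) (u : ℂ) : Op N := monodromy R K ξ u 0 1

/-- The entry `C^{(K)}(u)` of the monodromy matrix. -/
def opC {N : ℕ} (R : ℂ → Matrix (Fin 2 × Fin 2) (Fin 2 × Fin 2) ℂ)
    (K : Matrix (Fin 2) (Fin 2) ℂ) (ξ : Fin N → ℂ) (u : ℂ) : Op N := monodromy R K ξ u 1 0

/-- The entry `D^{(K)}(u)` of the monodromy matrix. -/
def opD {N : ℕ} (R : ℂ → Matrix (Fin 2 × Fin 2) (Fin 2 × Fin 2) ℂ)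
    (K : Matrix (Fin 2) (Fin 2) ℂ) (ξ : Fin N → ℂ) (u : ℂ) : Op N := monodromy R K ξ u 1 1

/-- The transfer matrix, the trace of the monodromy matrix over the auxiliary space. -/
def transfer {N : ℕ} (R : ℂ → Matrix (Fin 2 × Fin 2) (Fin 2 × Fin 2) ℂ)
    (K : Matrix (Fin 2) (Fin 2) ℂ) (ξ : Fin N → ℂ) (u : ℂ) : Op N := (monodromy R K ξ u).trace

/-- The antidiagonal twist `K^{(a=1,α)}`. -/
def antidiagTwist (α : ℂ) : Matrix (Fin 2) (Fin 2) ℂ :=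
  !![0, Complex.exp α; Complex.exp (-α), 0]

/-- `a(u) = ∏ₙ (u - ξₙ + η)`, rational case. -/
def rationalA {N : ℕ} (η : ℂ) (ξ : Fin N → ℂ) (u : ℂ) : ℂ := ∏ n, (u - ξ n + η)

/-- `a(u) = ∏ₙ sinh (u - ξₙ + η)`, trigonometric case. -/
def trigA {N : ℕ} (η : ℂ) (ξ : Fin N → ℂ) (u : ℂ) : ℂ := ∏ n, Complex.sinh (u - ξ n + η)

/-- The covector `⟨0| = ⊗ₙ (1, 0)`. -/
def refCov (N : ℕ) : Cov N := fun s => ∏ n, (![1, 0] : Fin 2 → ℂ) (s n)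

/-- The operator `⊗ₙ W` on the quantum space. -/
def tensorOp (N : ℕ) (W : Matrix (Fin 2) (Fin 2) ℂ) : Op N :=
  Matrix.of fun s t => ∏ n, W (s n) (t n)

/-- The covector `⟨S| ∏ₙ (Xₙ / cₙ)^{hₙ}`, with the factors in the order `n = 1, …, N`. -/
def sovCov {N : ℕ} (S : Cov N) (X : Fin N → Op N) (c : Fin N → ℂ) (h : Fin N → Fin 2) : Cov N :=
  S ᵥ* (List.ofFn fun n => ((c n)⁻¹ • X n) ^ (h n : ℕ)).prod

/-- `v` is a basis of the covectors, made of left eigencovectors of all the operators `B u`,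
with eigenvalues `e h u`. -/
structure IsLeftEigenbasis {N : ℕ} (B : ℂ → Op N) (v : (Fin N → Fin 2) → Cov N)
    (e : (Fin N → Fin 2) → ℂ → ℂ) : Prop where
  eigen : ∀ h u, v h ᵥ* B u = e h u • v h
  linearIndependent : LinearIndependent ℂ v
  span_eq_top : Submodule.span ℂ (Set.range v) = ⊤

/-- The operators `B u` are diagonalized by one and the same change of basis, and for all `u`
outside a closed discrete subset of `ℂ` the eigenvalues of `B u` are pairwise distinct. In
particular the joint spectrum of the family is simple. -/
def DiagonalizableSimple {N : ℕ} (B : ℂ → Op N) : Prop :=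
  ∃ (P : Op N) (d : ℂ → Conf N → ℂ), IsUnit P ∧ (∀ u, P * B u * P⁻¹ = Matrix.diagonal (d u)) ∧
    ∀ᶠ u in codiscrete ℂ, Function.Injective (d u)

end

end SoV

open SoV

/-!
The rational and the trigonometric six-vertex weights are both of the form `a = f (u + η)`,
`b = f u`, `c = f η`, with `f` odd and subject to one three-term identity
(`SoV.IsSixVertexFunction`); both models are treated at once through this function.

The identity gives the Yang-Baxter equation at one site (`SoV.IsSixVertexFunction.yangBaxter`).
The exchange relation is multiplicative in factors with commuting entries, so it holds for the
monodromy matrix with any twist `K` such that `K ⊗ K` commutes with `R`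
(`SoV.satisfiesRTT_monodromy`). The commutation of the `A (ξₙ)` and of the transfer matrices can be
read off from it. So can the action on a joint left eigencovector of the `B u` whose eigenvalue
`β u` vanishes at `x`: the operator `A x` replaces the factor `f (u - x)` of `β u` by
`f (u - x + η)`, and `D x` replaces it by `f (u - x - η)` (`SoV.vecMul_opA_vecMul_opB`,
`SoV.vecMul_opD_vecMul_opB`).

The reference covector has eigenvalue `K₀₁ ∏ₙ f (u - ξₙ)`, so repeated action of the `A (ξₙ)`
produces eigencovectors with the `2 ^ N` expected eigenvalues. They are not zero: the first row of
`K M(x)` times the quantum adjugate of `M(x - η)` is the first row of `K` times the quantum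
determinant, so a covector annihilated by both `A x` and `B x` vanishes
(`SoV.vecMul_opA_ne_zero`). Since only the entry `K₀₁` enters, singular twists need no separate
treatment. The eigenvalues are pairwise distinct as functions, being told apart by their zeros among
the `ξₙ`; by analyticity they are distinct off a closed discrete set, which gives the basis and the
diagonalization.

In the product of transfer matrices `A + D`, each `D (ξₙ)` acts on a joint eigencovector with
`hₙ = 0`, and would produce an eigenvalue with the factor `f (u - ξₙ - η)`. This is not in the joint
spectrum (`SoV.exists_eigB_ne`), so the term vanishes and only the `A (ξₙ)` remain
(`SoV.partialSovCov_transfer`).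

In the rational case `R` commutes with `W ⊗ W` for every `W`, so conjugating the twist is the same as
conjugating the transfer matrix by `W ⊗ ⋯ ⊗ W` (`SoV.transfer_rationalR_conj`). This reduces a general
twist to one with a non-zero upper right entry.
-/

namespace SoV

/-! ### Six-vertex weights -/

/-- The functions `f` for which the six-vertex weights `a = f (u + η)`, `b = f u`, `c = f η` solve
the Yang-Baxter equation by a single three-term identity. The theorem needs `f = id` and
`f = sinh`. -/
structure IsSixVertexFunction (f : ℂ → ℂ) : Prop where
  differentiable : Differentiable ℂ f
  odd : ∀ x, f (-x) = -f x
  threeTerm : ∀ x y z, f (x + z) * f y - f x * f (y + z) = f z * f (y - x)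

/-- The six-vertex `R`-matrix with weights `a`, `b`, `c`. -/
def sixVertex (a b c : ℂ) : Matrix (Fin 2 × Fin 2) (Fin 2 × Fin 2) ℂ :=
  onPair !![a, 0, 0, 0;
            0, b, c, 0;
            0, c, b, 0;
            0, 0, 0, a]

/-- The six-vertex `R`-matrix of the function `f`. -/
def sixVertexR (f : ℂ → ℂ) (η u : ℂ) : Matrix (Fin 2 × Fin 2) (Fin 2 × Fin 2) ℂ :=
  sixVertex (f (u + η)) (f u) (f η)

theorem rationalR_eq (η : ℂ) : rationalR η = sixVertexR id η := rfl

theorem sixVertex_apply (a b c : ℂ) (i p j q : Fin 2) :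
    sixVertex a b c (i, p) (j, q) =
      if i = j ∧ p = q then (if i = p then a else b) else if i = q ∧ p = j then c else 0 := by
  fin_cases i <;> fin_cases p <;> fin_cases j <;> fin_cases q <;> rfl

theorem isSixVertexFunction_id : IsSixVertexFunction id where
  differentiable := differentiable_id
  odd _ := rfl
  threeTerm x y z := by simp only [id]; ring

theorem isSixVertexFunction_sinh : IsSixVertexFunction Complex.sinh where
  differentiable := Complex.differentiable_sinh
  odd := Complex.sinh_neg
  threeTerm x y z := by
    simp only [Complex.sinh_add, Complex.sinh_sub]
    ring

theorem IsSixVertexFunction.map_zero {f : ℂ → ℂ} (hf : IsSixVertexFunction f) : f 0 = 0 := by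
  have h := hf.odd 0
  rw [neg_zero] at h
  linear_combination h / 2

theorem IsSixVertexFunction.mul_eq_sq_sub_sq {f : ℂ → ℂ} (hf : IsSixVertexFunction f) (x y : ℂ) :
    f (x + y) * f (x - y) = f x ^ 2 - f y ^ 2 := by
  have h := hf.threeTerm y (-x) (x - y)
  rw [show y + (x - y) = x by ring, show -x + (x - y) = -y by ring,
    show -x - y = -(x + y) by ring, hf.odd, hf.odd, hf.odd] at h
  linear_combination h

/-! ### The exchange relation -/

section EntriesCommute

variable {A : Type*} [Ring A]

/-- A `2 × 2` matrix of operators, acting on the first of two auxiliary spaces. -/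
def auxFst (X : Matrix (Fin 2) (Fin 2) A) : Matrix (Fin 2 × Fin 2) (Fin 2 × Fin 2) A :=
  Matrix.of fun p q => if p.2 = q.2 then X p.1 q.1 else 0

/-- A `2 × 2` matrix of operators, acting on the second of two auxiliary spaces. -/
def auxSnd (X : Matrix (Fin 2) (Fin 2) A) : Matrix (Fin 2 × Fin 2) (Fin 2 × Fin 2) A :=
  Matrix.of fun p q => if p.1 = q.1 then X p.2 q.2 else 0

/-- Every entry of `X` commutes with every entry of `Y`. -/
def EntriesCommute (X Y : Matrix (Fin 2) (Fin 2) A) : Prop :=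
  ∀ i j k l, Commute (X i j) (Y k l)

theorem EntriesCommute.symm {X Y : Matrix (Fin 2) (Fin 2) A} (h : EntriesCommute X Y) :
    EntriesCommute Y X := fun i j k l => (h k l i j).symm

theorem EntriesCommute.mul_right {X Y Z : Matrix (Fin 2) (Fin 2) A} (hY : EntriesCommute X Y)
    (hZ : EntriesCommute X Z) : EntriesCommute X (Y * Z) := fun i j k l => by
  simp only [mul_apply, Fin.sum_univ_two]
  exact ((hY _ _ _ _).mul_right (hZ _ _ _ _)).add_right ((hY _ _ _ _).mul_right (hZ _ _ _ _))

theorem EntriesCommute.one_right (X : Matrix (Fin 2) (Fin 2) A) : EntriesCommute X 1 :=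
  fun i j k l => by
    rw [one_apply]
    split_ifs
    exacts [Commute.one_right _, Commute.zero_right _]

theorem auxFst_mul (X Y : Matrix (Fin 2) (Fin 2) A) : auxFst (X * Y) = auxFst X * auxFst Y := by
  ext ⟨i, p⟩ ⟨j, q⟩
  simp only [auxFst, mul_apply, of_apply, Fintype.sum_prod_type, Fin.sum_univ_two]
  fin_cases p <;> fin_cases q <;> simp

theorem auxSnd_mul (X Y : Matrix (Fin 2) (Fin 2) A) : auxSnd (X * Y) = auxSnd X * auxSnd Y := by
  ext ⟨i, p⟩ ⟨j, q⟩
  simp only [auxSnd, mul_apply, of_apply, Fintype.sum_prod_type, Fin.sum_univ_two]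
  fin_cases i <;> fin_cases j <;> simp

theorem EntriesCommute.auxFst_mul_auxSnd {X Y : Matrix (Fin 2) (Fin 2) A}
    (h : EntriesCommute X Y) : auxFst X * auxSnd Y = auxSnd Y * auxFst X := by
  ext ⟨i, p⟩ ⟨j, q⟩
  simp only [auxFst, auxSnd, mul_apply, of_apply, Fintype.sum_prod_type, ite_mul, zero_mul,
    mul_ite, mul_zero, Finset.sum_ite_eq, Finset.sum_ite_eq', Finset.mem_univ, if_true,
    Finset.sum_ite_irrel, Finset.sum_const_zero]
  exact h _ _ _ _

end EntriesCommute

section RTT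

variable {A B : Type*} [Ring A] [Algebra ℂ A] [Ring B] [Algebra ℂ B]

theorem entriesCommute_algebraMap (K : Matrix (Fin 2) (Fin 2) ℂ) (X : Matrix (Fin 2) (Fin 2) A) :
    EntriesCommute (K.map (algebraMap ℂ A)) X := fun _ _ _ _ => Algebra.commutes _ _

/-- The exchange relation `r X₁ Y₂ = Y₂ X₁ r` on two auxiliary spaces. -/
def SatisfiesRTT (r : Matrix (Fin 2 × Fin 2) (Fin 2 × Fin 2) ℂ)
    (X Y : Matrix (Fin 2) (Fin 2) A) : Prop :=
  r.map (algebraMap ℂ A) * (auxFst X * auxSnd Y) = auxSnd Y * auxFst X * r.map (algebraMap ℂ A)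

theorem SatisfiesRTT.mul {r : Matrix (Fin 2 × Fin 2) (Fin 2 × Fin 2) ℂ}
    {X Y X' Y' : Matrix (Fin 2) (Fin 2) A} (h : SatisfiesRTT r X Y) (h' : SatisfiesRTT r X' Y')
    (c : EntriesCommute X' Y) (c' : EntriesCommute X Y') :
    SatisfiesRTT r (X * X') (Y * Y') := by
  unfold SatisfiesRTT at *
  set S := r.map (algebraMap ℂ A)
  rw [auxFst_mul, auxSnd_mul]
  calc S * (auxFst X * auxFst X' * (auxSnd Y * auxSnd Y'))
      = S * (auxFst X * (auxFst X' * auxSnd Y) * auxSnd Y') := by simp only [mul_assoc]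
    _ = (S * (auxFst X * auxSnd Y)) * (auxFst X' * auxSnd Y') := by
        rw [c.auxFst_mul_auxSnd]; simp only [mul_assoc]
    _ = auxSnd Y * auxFst X * (S * (auxFst X' * auxSnd Y')) := by rw [h]; simp only [mul_assoc]
    _ = auxSnd Y * (auxFst X * auxSnd Y') * (auxFst X' * S) := by rw [h']; simp only [mul_assoc]
    _ = auxSnd Y * auxSnd Y' * (auxFst X * auxFst X') * S := by
        rw [c'.auxFst_mul_auxSnd]; simp only [mul_assoc]

theorem satisfiesRTT_one (r : Matrix (Fin 2 × Fin 2) (Fin 2 × Fin 2) ℂ) :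
    SatisfiesRTT r (1 : Matrix (Fin 2) (Fin 2) A) 1 := by
  have h1 : auxFst (1 : Matrix (Fin 2) (Fin 2) A) = 1 := by
    ext ⟨i, p⟩ ⟨j, q⟩
    simp [auxFst, one_apply, ← ite_and, and_comm]
  have h2 : auxSnd (1 : Matrix (Fin 2) (Fin 2) A) = 1 := by
    ext ⟨i, p⟩ ⟨j, q⟩
    simp [auxSnd, one_apply, ← ite_and]
  simp [SatisfiesRTT, h1, h2]

theorem SatisfiesRTT.map {r : Matrix (Fin 2 × Fin 2) (Fin 2 × Fin 2) ℂ}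
    {X Y : Matrix (Fin 2) (Fin 2) A} (h : SatisfiesRTT r X Y) (φ : A →ₐ[ℂ] B) :
    SatisfiesRTT r (X.map φ) (Y.map φ) := by
  have h1 : ∀ Z : Matrix (Fin 2) (Fin 2) A, auxFst (Z.map φ) = (auxFst Z).map φ := fun Z => by
    ext ⟨i, p⟩ ⟨j, q⟩
    simp [auxFst, apply_ite φ]
  have h2 : ∀ Z : Matrix (Fin 2) (Fin 2) A, auxSnd (Z.map φ) = (auxSnd Z).map φ := fun Z => by
    ext ⟨i, p⟩ ⟨j, q⟩
    simp [auxSnd, apply_ite φ]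
  have h3 : r.map (algebraMap ℂ B) = (r.map (algebraMap ℂ A)).map φ := by
    ext p q
    simp
  unfold SatisfiesRTT at *
  rw [h1, h2, h3]
  have := congrArg (fun Z => Z.map φ) h
  simpa only [Matrix.map_mul] using this

/-- The exchange relation for six-vertex weights, entry by entry. -/
theorem SatisfiesRTT.apply {a b c : ℂ} {X Y : Matrix (Fin 2) (Fin 2) A}
    (h : SatisfiesRTT (sixVertex a b c) X Y) (i p j q : Fin 2) :
    (if i = p then a • (X i j * Y p q) else b • (X i j * Y p q) + c • (X p j * Y i q)) =
      if j = q then a • (Y p q * X i j) else b • (Y p q * X i j) + c • (Y p j * X i q) := by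
  have := congrFun (congrFun h (i, p)) (j, q)
  simp only [mul_apply, Matrix.map_apply, sixVertex_apply, auxFst, auxSnd, of_apply,
    Fintype.sum_prod_type, Fin.sum_univ_two, ← Algebra.smul_def, ← Algebra.commutes] at this
  fin_cases i <;> fin_cases p <;> fin_cases j <;> fin_cases q <;> simpa [add_comm] using this

theorem satisfiesRTT_of_apply {a b c : ℂ} {X Y : Matrix (Fin 2) (Fin 2) A}
    (h : ∀ i p j q : Fin 2,
      (if i = p then a • (X i j * Y p q) else b • (X i j * Y p q) + c • (X p j * Y i q)) =
        if j = q then a • (Y p q * X i j) else b • (Y p q * X i j) + c • (Y p j * X i q)) :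
    SatisfiesRTT (sixVertex a b c) X Y := by
  unfold SatisfiesRTT
  ext ⟨i, p⟩ ⟨j, q⟩
  have := h i p j q
  simp only [mul_apply, Matrix.map_apply, sixVertex_apply, auxFst, auxSnd, of_apply,
    Fintype.sum_prod_type, Fin.sum_univ_two, ← Algebra.smul_def, ← Algebra.commutes]
  clear h
  fin_cases i <;> fin_cases p <;> fin_cases j <;> fin_cases q <;> simpa [add_comm] using this

end RTT

/-- One site of the monodromy matrix, as a `2 × 2` matrix in the auxiliary space with entries in
the operators on `ℂ²`. -/
def localLax (R : Matrix (Fin 2 × Fin 2) (Fin 2 × Fin 2) ℂ) :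
    Matrix (Fin 2) (Fin 2) (Matrix (Fin 2) (Fin 2) ℂ) :=
  Matrix.of fun i j => Matrix.of fun p q => R (i, p) (j, q)

/-- The Yang-Baxter equation for the six-vertex `R`-matrix of `f`. -/
theorem IsSixVertexFunction.yangBaxter {f : ℂ → ℂ} (hf : IsSixVertexFunction f) (η u v : ℂ) :
    SatisfiesRTT (sixVertexR f η (u - v)) (localLax (sixVertexR f η u))
      (localLax (sixVertexR f η v)) := by
  -- three instances of the three-term identity imply all entries of the equation
  have h1 := hf.threeTerm u v η
  have h2 := hf.threeTerm (u - v) u η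
  have h3 := hf.threeTerm (u - v) (-v - η) η
  rw [show u - (u - v) = v by ring] at h2
  rw [show -v - η + η = -v by ring, show -v - η = -(v + η) by ring,
    show -(v + η) - (u - v) = -(u + η) by ring, hf.odd, hf.odd, hf.odd] at h3
  rw [show v - u = -(u - v) by ring, hf.odd] at h1
  refine satisfiesRTT_of_apply fun i p j q => ?_
  fin_cases i <;> fin_cases p <;> fin_cases j <;> fin_cases q <;> ext s t <;>
    fin_cases s <;> fin_cases t <;>
    simp [localLax, sixVertexR, mul_apply, sixVertex_apply] <;> grind

/-! ### Operators on the quantum space -/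

variable {N : ℕ}

/-- The operator `⊗ₙ wₙ` on the quantum space. -/
def productOp (w : Fin N → Matrix (Fin 2) (Fin 2) ℂ) : Op N :=
  Matrix.of fun s t => ∏ n, w n (s n) (t n)

theorem productOp_mul (w z : Fin N → Matrix (Fin 2) (Fin 2) ℂ) :
    productOp w * productOp z = productOp (w * z) := by
  ext s t
  simp only [productOp, mul_apply, of_apply, Pi.mul_apply, Fintype.prod_sum,
    Finset.prod_mul_distrib]

theorem productOp_one : productOp (1 : Fin N → Matrix (Fin 2) (Fin 2) ℂ) = 1 := by
  ext s t
  simp only [productOp, of_apply, Pi.one_apply, one_apply, Finset.prod_ite_zero,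
    Finset.prod_const_one, Finset.mem_univ, true_imp_iff, funext_iff]

theorem siteOp_eq_productOp (n : Fin N) (X : Matrix (Fin 2) (Fin 2) ℂ) :
    siteOp n X = productOp (Function.update 1 n X) := by
  ext s t
  simp only [siteOp, productOp, of_apply]
  rw [← Finset.mul_prod_erase _ _ (Finset.mem_univ n), Function.update_self]
  have : ∏ m ∈ Finset.univ.erase n,
      (Function.update (1 : Fin N → Matrix (Fin 2) (Fin 2) ℂ) n X) m (s m) (t m) =
        ∏ m ∈ Finset.univ.erase n, if s m = t m then 1 else 0 :=
    Finset.prod_congr rfl fun m hm => by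
      rw [Function.update_of_ne (Finset.ne_of_mem_erase hm), Pi.one_apply, one_apply]
  rw [this, Finset.prod_ite_zero]
  simp

/-- Operators on `ℂ²`, acting on the `n`-th factor of the quantum space. -/
def siteHom (n : Fin N) : Matrix (Fin 2) (Fin 2) ℂ →ₐ[ℂ] Op N :=
  AlgHom.ofLinearMap
    { toFun := siteOp n
      map_add' := fun X Y => by
        ext s t
        simp only [siteOp, of_apply, Matrix.add_apply]
        split_ifs
        exacts [rfl, (add_zero _).symm]
      map_smul' := fun c X => by
        ext s t
        simp [siteOp] }
    (by
      change siteOp n 1 = 1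
      rw [siteOp_eq_productOp, ← productOp_one]
      exact congrArg _ (Function.update_eq_self n 1))
    (fun X Y => by
      change siteOp n (X * Y) = siteOp n X * siteOp n Y
      rw [siteOp_eq_productOp, siteOp_eq_productOp, siteOp_eq_productOp, productOp_mul,
        ← Function.update_mul, one_mul])

theorem siteHom_apply (n : Fin N) (X : Matrix (Fin 2) (Fin 2) ℂ) : siteHom n X = siteOp n X := rfl

theorem commute_siteOp {m n : Fin N} (h : m ≠ n) (X Y : Matrix (Fin 2) (Fin 2) ℂ) :
    Commute (siteOp m X) (siteOp n Y) := by
  rw [Commute, SemiconjBy, siteOp_eq_productOp, siteOp_eq_productOp, productOp_mul, productOp_mul]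
  congr 1
  funext k
  rcases eq_or_ne k m with rfl | hm
  · simp [h]
  · simp [Function.update_of_ne hm]

/-! ### The monodromy matrix -/

theorem laxOp_eq (R : Matrix (Fin 2 × Fin 2) (Fin 2 × Fin 2) ℂ) (n : Fin N) :
    laxOp R n = (localLax R).map (siteHom n) := rfl

/-- The product of the operators `(L n)_{0,n}` over the sites `n` of a list. -/
def laxProd (L : Fin N → Matrix (Fin 2 × Fin 2) (Fin 2 × Fin 2) ℂ) (l : List (Fin N)) :
    Matrix (Fin 2) (Fin 2) (Op N) :=
  (l.map fun n => laxOp (L n) n).prod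

theorem laxProd_cons (L : Fin N → Matrix (Fin 2 × Fin 2) (Fin 2 × Fin 2) ℂ) (n : Fin N)
    (l : List (Fin N)) : laxProd L (n :: l) = laxOp (L n) n * laxProd L l := by
  simp [laxProd]

theorem monodromy_eq (R : ℂ → Matrix (Fin 2 × Fin 2) (Fin 2 × Fin 2) ℂ)
    (K : Matrix (Fin 2) (Fin 2) ℂ) (ξ : Fin N → ℂ) (u : ℂ) :
    monodromy R K ξ u =
      K.map (algebraMap ℂ (Op N)) * laxProd (fun n => R (u - ξ n)) (List.finRange N).reverse := by
  rw [monodromy, laxProd, List.ofFn_eq_map, List.map_reverse]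

theorem entriesCommute_laxProd {R : Matrix (Fin 2 × Fin 2) (Fin 2 × Fin 2) ℂ}
    (L : Fin N → Matrix (Fin 2 × Fin 2) (Fin 2 × Fin 2) ℂ) {m : Fin N} {l : List (Fin N)}
    (h : m ∉ l) : EntriesCommute (laxOp R m) (laxProd L l) := by
  induction l with
  | nil => exact EntriesCommute.one_right _
  | cons n l ih =>
    rw [List.mem_cons, not_or] at h
    rw [laxProd_cons]
    exact EntriesCommute.mul_right (fun i j k l => commute_siteOp h.1 _ _) (ih h.2)

theorem satisfiesRTT_laxProd {r : Matrix (Fin 2 × Fin 2) (Fin 2 × Fin 2) ℂ}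
    {L L' : Fin N → Matrix (Fin 2 × Fin 2) (Fin 2 × Fin 2) ℂ}
    (h : ∀ n, SatisfiesRTT r (localLax (L n)) (localLax (L' n))) {l : List (Fin N)}
    (hl : l.Nodup) : SatisfiesRTT r (laxProd L l) (laxProd L' l) := by
  induction l with
  | nil => exact satisfiesRTT_one r
  | cons n l ih =>
    rw [List.nodup_cons] at hl
    rw [laxProd_cons, laxProd_cons]
    exact ((h n).map (siteHom n)).mul (ih hl.2) (entriesCommute_laxProd _ hl.1).symm
      (entriesCommute_laxProd _ hl.1)

/-- The exchange relation of the twisted monodromy matrix, for a twist `K` that commutes with the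
`R`-matrix in the sense `R K₁ K₂ = K₂ K₁ R`. -/
theorem satisfiesRTT_monodromy {f : ℂ → ℂ} (hf : IsSixVertexFunction f) {η : ℂ}
    {K : Matrix (Fin 2) (Fin 2) ℂ} (hK : ∀ u, SatisfiesRTT (sixVertexR f η u) K K)
    (ξ : Fin N → ℂ) (u v : ℂ) :
    SatisfiesRTT (sixVertexR f η (u - v)) (monodromy (sixVertexR f η) K ξ u)
      (monodromy (sixVertexR f η) K ξ v) := by
  rw [monodromy_eq, monodromy_eq]
  refine ((hK _).map (Algebra.ofId ℂ (Op N))).mul (satisfiesRTT_laxProd (fun n => ?_)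
    (List.nodup_reverse.2 (List.nodup_finRange N))) (entriesCommute_algebraMap _ _).symm
    (entriesCommute_algebraMap _ _)
  simpa using hf.yangBaxter η (u - ξ n) (v - ξ n)

/-! ### The quantum determinant -/

section QuantumAdjugate

variable {A B : Type*} [Ring A] [Ring B]

/-- The adjugate `σʸ Xᵗ σʸ` of a `2 × 2` matrix of operators. -/
def quantumAdjugate (X : Matrix (Fin 2) (Fin 2) A) : Matrix (Fin 2) (Fin 2) A :=
  !![X 1 1, -X 0 1; -X 1 0, X 0 0]

theorem EntriesCommute.quantumAdjugate_mul {X Y : Matrix (Fin 2) (Fin 2) A}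
    (h : EntriesCommute X Y) :
    quantumAdjugate (X * Y) = quantumAdjugate Y * quantumAdjugate X := by
  ext i j
  fin_cases i <;> fin_cases j <;>
    simp [quantumAdjugate, mul_apply, Fin.sum_univ_two, (h _ _ _ _).eq, add_comm]

theorem quantumAdjugate_one : quantumAdjugate (1 : Matrix (Fin 2) (Fin 2) A) = 1 := by
  ext i j
  fin_cases i <;> fin_cases j <;> simp [quantumAdjugate]

theorem quantumAdjugate_map (X : Matrix (Fin 2) (Fin 2) A) (φ : A →+* B) :
    quantumAdjugate (X.map φ) = (quantumAdjugate X).map φ := by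
  ext i j
  fin_cases i <;> fin_cases j <;> simp [quantumAdjugate]

end QuantumAdjugate

/-- Crossing unitarity at one site: the quantum determinant of a single Lax operator is a scalar. -/
theorem IsSixVertexFunction.localLax_mul_quantumAdjugate {f : ℂ → ℂ} (hf : IsSixVertexFunction f)
    (η u : ℂ) :
    localLax (sixVertexR f η u) * quantumAdjugate (localLax (sixVertexR f η (u - η))) =
      algebraMap ℂ _ (f (u + η) * f (u - η)) := by
  have h := hf.mul_eq_sq_sub_sq u η
  ext i j s t
  fin_cases i <;> fin_cases j <;> fin_cases s <;> fin_cases t <;>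
    simp [localLax, sixVertexR, mul_apply, sixVertex_apply, quantumAdjugate,
      algebraMap_matrix_apply] <;> grind

/-- The quantum determinant of a product of sites is the product of those of the sites. -/
theorem laxProd_mul_quantumAdjugate {L L' : Fin N → Matrix (Fin 2 × Fin 2) (Fin 2 × Fin 2) ℂ}
    {q : Fin N → ℂ}
    (h : ∀ n, localLax (L n) * quantumAdjugate (localLax (L' n)) = algebraMap ℂ _ (q n))
    {l : List (Fin N)} (hl : l.Nodup) :
    laxProd L l * quantumAdjugate (laxProd L' l) = algebraMap ℂ _ (l.map q).prod := by
  induction l with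
  | nil => simp [laxProd, quantumAdjugate_one]
  | cons n l ih =>
    rw [List.nodup_cons] at hl
    have hn : laxOp (L n) n * quantumAdjugate (laxOp (L' n) n) =
        algebraMap ℂ (Matrix (Fin 2) (Fin 2) (Op N)) (q n) := by
      have h1 := quantumAdjugate_map (localLax (L' n)) (siteHom n : _ →+* Op N)
      have h2 := congrArg (fun X => X.map (siteHom n)) (h n)
      simp only [Matrix.map_mul] at h2
      rw [laxOp_eq, laxOp_eq]
      refine (congrArg _ h1).trans (h2.trans ?_)
      ext1 i j
      simp only [Matrix.map_apply, algebraMap_matrix_apply]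
      split_ifs <;> simp
    rw [laxProd_cons, laxProd_cons, (entriesCommute_laxProd L' hl.1).quantumAdjugate_mul,
      List.map_cons, List.prod_cons, map_mul, ← hn, mul_assoc, ← mul_assoc (laxProd L l),
      ih hl.2, Algebra.commutes, mul_assoc]

/-! ### Conjugation by a tensor power -/

theorem tensorOp_mul (W Z : Matrix (Fin 2) (Fin 2) ℂ) :
    tensorOp N W * tensorOp N Z = tensorOp N (W * Z) :=
  productOp_mul (fun _ => W) (fun _ => Z)

theorem isUnit_tensorOp {W : Matrix (Fin 2) (Fin 2) ℂ} (hW : IsUnit W) :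
    IsUnit (tensorOp N W) := by
  obtain ⟨⟨W, Z, h1, h2⟩, rfl⟩ := hW
  have h : tensorOp N (1 : Matrix (Fin 2) (Fin 2) ℂ) = 1 := productOp_one
  exact ⟨⟨tensorOp N W, tensorOp N Z, by rw [tensorOp_mul, h1, h], by rw [tensorOp_mul, h2, h]⟩,
    rfl⟩

theorem tensorOp_mul_siteOp {W X Y : Matrix (Fin 2) (Fin 2) ℂ} (h : W * X = Y * W) (n : Fin N) :
    tensorOp N W * siteOp n X = siteOp n Y * tensorOp N W := by
  rw [siteOp_eq_productOp, siteOp_eq_productOp, show tensorOp N W = productOp fun _ => W from rfl,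
    productOp_mul, productOp_mul]
  congr 1
  funext m
  rcases eq_or_ne m n with rfl | hm
  · simpa using h
  · simp [Function.update_of_ne hm]

/-- The rational `R`-matrix commutes with `W ⊗ W`, hence its Lax operator commutes with
`W₀ ⊗ W^{⊗ N}`. -/
theorem commute_laxOp_rationalR (η u : ℂ) (W : Matrix (Fin 2) (Fin 2) ℂ) (n : Fin N) :
    Commute (W.map (algebraMap ℂ (Op N)) * diagonal fun _ => tensorOp N W)
      (laxOp (rationalR η u) n) := by
  have key : ∀ i j, W * (∑ k, W i k • localLax (rationalR η u) k j) =
      (∑ k, W k j • localLax (rationalR η u) i k) * W := by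
    intro i j
    rw [rationalR_eq]
    ext s t
    fin_cases i <;> fin_cases j <;> fin_cases s <;> fin_cases t <;>
      simp [localLax, sixVertexR, mul_apply, sixVertex_apply] <;> ring
  rw [Commute, SemiconjBy]
  ext1 i j
  have h := tensorOp_mul_siteOp (key i j) n
  rw [← siteHom_apply, ← siteHom_apply, map_sum, map_sum] at h
  simp only [map_smul, Finset.mul_sum, Finset.sum_mul, mul_smul_comm, smul_mul_assoc] at h
  rw [laxOp_eq, ← mul_assoc, mul_diagonal, mul_apply, mul_apply]
  simp only [mul_diagonal, Matrix.map_apply]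
  simpa [Algebra.algebraMap_eq_smul_one, Fin.sum_univ_two, add_mul] using h

/-! ### Consequences of the exchange relation -/

theorem EntriesCommute.trace_mul_comm {A : Type*} [Ring A] {X Y : Matrix (Fin 2) (Fin 2) A}
    (h : EntriesCommute X Y) : (X * Y).trace = (Y * X).trace := by
  simp only [trace, diag_apply, mul_apply]
  rw [Finset.sum_comm]
  exact Finset.sum_congr rfl fun i _ => Finset.sum_congr rfl fun j _ => (h _ _ _ _).eq

section

variable {A : Type*} [Ring A] [Algebra ℂ A]

theorem SatisfiesRTT.commute_diag {a b c : ℂ} {X Y : Matrix (Fin 2) (Fin 2) A}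
    (h : SatisfiesRTT (sixVertex a b c) X Y) (ha : a ≠ 0) (i : Fin 2) :
    Commute (X i i) (Y i i) := by
  have := h.apply i i i i
  rw [if_pos rfl, if_pos rfl] at this
  exact smul_right_injective A ha this

/-- The transfer matrices commute when the six-vertex `R`-matrix is invertible. -/
theorem SatisfiesRTT.commute_trace {a b c : ℂ} {X Y : Matrix (Fin 2) (Fin 2) A}
    (h : SatisfiesRTT (sixVertex a b c) X Y) (ha : a ≠ 0) (hbc : b ^ 2 - c ^ 2 ≠ 0) :
    Commute X.trace Y.trace := by
  have e1 : b • (X 0 0 * Y 1 1) + c • (X 1 0 * Y 0 1) =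
    b • (Y 1 1 * X 0 0) + c • (Y 1 0 * X 0 1) := by simpa using h.apply 0 1 0 1
  have e2 : b • (X 1 1 * Y 0 0) + c • (X 0 1 * Y 1 0) =
    b • (Y 0 0 * X 1 1) + c • (Y 0 1 * X 1 0) := by simpa using h.apply 1 0 1 0
  have e3 : b • (X 0 1 * Y 1 0) + c • (X 1 1 * Y 0 0) =
    b • (Y 1 0 * X 0 1) + c • (Y 1 1 * X 0 0) := by simpa using h.apply 0 1 1 0
  have e4 : b • (X 1 0 * Y 0 1) + c • (X 0 0 * Y 1 1) =
    b • (Y 0 1 * X 1 0) + c • (Y 0 0 * X 1 1) := by simpa using h.apply 1 0 0 1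
  -- eliminating the mixed commutators of off-diagonal entries leaves the factor `b² - c²`
  have key : X 0 0 * Y 1 1 + X 1 1 * Y 0 0 = Y 1 1 * X 0 0 + Y 0 0 * X 1 1 := by
    refine smul_right_injective A hbc ?_
    simp only
    linear_combination (norm := module) b • e1 + b • e2 - c • e3 - c • e4
  have h0 := (h.commute_diag ha 0).eq
  have h1 := (h.commute_diag ha 1).eq
  rw [Commute, SemiconjBy, trace_fin_two, trace_fin_two]
  simp only [add_mul, mul_add, h0, h1]
  linear_combination (norm := module) key

end

section Monodromy

variable {f : ℂ → ℂ} {η : ℂ} {K : Matrix (Fin 2) (Fin 2) ℂ} {ξ : Fin N → ℂ} {w : Cov N}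

theorem commute_opA (hf : IsSixVertexFunction f)
    (hK : ∀ u, SatisfiesRTT (sixVertexR f η u) K K) {u v : ℂ} (h : f (u - v + η) ≠ 0) :
    Commute (opA (sixVertexR f η) K ξ u) (opA (sixVertexR f η) K ξ v) :=
  (satisfiesRTT_monodromy hf hK ξ u v).commute_diag h 0

theorem commute_transfer (hf : IsSixVertexFunction f)
    (hK : ∀ u, SatisfiesRTT (sixVertexR f η u) K K) {u v : ℂ} (h : f (u - v + η) ≠ 0)
    (h' : f (v - u + η) ≠ 0) :
    Commute (transfer (sixVertexR f η) K ξ u) (transfer (sixVertexR f η) K ξ v) := by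
  refine (satisfiesRTT_monodromy hf hK ξ u v).commute_trace h ?_
  rw [← hf.mul_eq_sq_sub_sq, show u - v - η = -(v - u + η) by ring, hf.odd]
  exact mul_ne_zero h (neg_ne_zero.2 h')

theorem continuous_monodromy (hf : IsSixVertexFunction f) :
    Continuous fun u => monodromy (sixVertexR f η) K ξ u := by
  have hc := hf.differentiable.continuous
  simp only [monodromy_eq, laxProd]
  refine continuous_const.mul (continuous_list_prod _ fun n _ => ?_)
  refine continuous_matrix fun i j => continuous_matrix fun s t => ?_
  simp only [laxOp, siteOp, of_apply, sixVertexR, sixVertex_apply]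
  split_ifs <;> fun_prop

/-- A common factor `f (u - x)` can be cancelled from an identity between continuous functions. -/
theorem IsSixVertexFunction.eq_of_smul_eq (hf : IsSixVertexFunction f) (hη : f η ≠ 0)
    {F G : ℂ → Cov N} (hF : Continuous F) (hG : Continuous G) (x : ℂ)
    (h : ∀ u, f (u - x) • F u = f (u - x) • G u) (u : ℂ) : F u = G u := by
  have ha : AnalyticOnNhd ℂ (fun u => f (u - x)) Set.univ := fun z _ =>
    (hf.differentiable.comp (differentiable_id.sub_const x)).analyticAt z
  have hz : (fun u => f (u - x)) ⁻¹' {0}ᶜ ∈ codiscrete ℂ :=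
    ha.preimage_zero_mem_codiscrete (x := x + η) (by simpa using hη)
  have hev : F =ᶠ[nhdsWithin u {u}ᶜ] G := by
    have := mem_codiscrete.1 hz u
    rw [disjoint_principal_right, compl_compl] at this
    filter_upwards [this] with v hv
    exact smul_right_injective _ hv (h v)
  exact tendsto_nhds_unique_of_eventuallyEq (hF.continuousAt.mono_left nhdsWithin_le_nhds)
    (hG.continuousAt.mono_left nhdsWithin_le_nhds) hev

/-- The operator `A x` moves the zero `x` of a `B`-eigenvalue to `x - η`. -/
theorem vecMul_opA_vecMul_opB (hf : IsSixVertexFunction f) (hη : f η ≠ 0)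
    (hK : ∀ u, SatisfiesRTT (sixVertexR f η u) K K) {x : ℂ} {g : ℂ → ℂ} (hg : Continuous g)
    (hw : ∀ u, w ᵥ* opB (sixVertexR f η) K ξ u = (f (u - x) * g u) • w) (u : ℂ) :
    (w ᵥ* opA (sixVertexR f η) K ξ x) ᵥ* opB (sixVertexR f η) K ξ u =
      (f (u - x + η) * g u) • (w ᵥ* opA (sixVertexR f η) K ξ x) := by
  have hB : Continuous fun u => opB (sixVertexR f η) K ξ u :=
    (continuous_monodromy hf).matrix_elem 0 1
  have hc := hf.differentiable.continuous
  refine hf.eq_of_smul_eq hη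
    (F := fun u => (w ᵥ* opA (sixVertexR f η) K ξ x) ᵥ* opB (sixVertexR f η) K ξ u)
    (G := fun u => (f (u - x + η) * g u) • (w ᵥ* opA (sixVertexR f η) K ξ x))
    (continuous_const.matrix_vecMul hB) (by fun_prop) x (fun u => ?_) u
  have hx : w ᵥ* opB (sixVertexR f η) K ξ x = 0 := by rw [hw, sub_self, hf.map_zero]; simp
  have h : f (u - x + η) • (opB (sixVertexR f η) K ξ u * opA (sixVertexR f η) K ξ x) =
      f (u - x) • (opA (sixVertexR f η) K ξ x * opB (sixVertexR f η) K ξ u) +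
        f η • (opB (sixVertexR f η) K ξ x * opA (sixVertexR f η) K ξ u) := by
    simpa [opA, opB, opD] using (satisfiesRTT_monodromy hf hK ξ u x).apply 0 0 1 0
  have h' := congrArg (fun X => w ᵥ* X) h
  simp only [vecMul_add, vecMul_smul, ← vecMul_vecMul, hx, zero_vecMul, smul_zero, add_zero,
    hw u, smul_vecMul] at h'
  rw [← h', smul_smul, smul_smul]
  congr 1
  ring

/-- The operator `D x` moves the zero `x` of a `B`-eigenvalue to `x + η`. -/
theorem vecMul_opD_vecMul_opB (hf : IsSixVertexFunction f) (hη : f η ≠ 0)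
    (hK : ∀ u, SatisfiesRTT (sixVertexR f η u) K K) {x : ℂ} {g : ℂ → ℂ} (hg : Continuous g)
    (hw : ∀ u, w ᵥ* opB (sixVertexR f η) K ξ u = (f (u - x) * g u) • w) (u : ℂ) :
    (w ᵥ* opD (sixVertexR f η) K ξ x) ᵥ* opB (sixVertexR f η) K ξ u =
      (f (u - x - η) * g u) • (w ᵥ* opD (sixVertexR f η) K ξ x) := by
  have hB : Continuous fun u => opB (sixVertexR f η) K ξ u :=
    (continuous_monodromy hf).matrix_elem 0 1
  have hc := hf.differentiable.continuous
  refine hf.eq_of_smul_eq hη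
    (F := fun u => (w ᵥ* opD (sixVertexR f η) K ξ x) ᵥ* opB (sixVertexR f η) K ξ u)
    (G := fun u => (f (u - x - η) * g u) • (w ᵥ* opD (sixVertexR f η) K ξ x))
    (continuous_const.matrix_vecMul hB) (by fun_prop) x (fun u => ?_) u
  have hx : w ᵥ* opB (sixVertexR f η) K ξ x = 0 := by rw [hw, sub_self, hf.map_zero]; simp
  have h : f (x - u) • (opD (sixVertexR f η) K ξ x * opB (sixVertexR f η) K ξ u) +
        f η • (opB (sixVertexR f η) K ξ x * opD (sixVertexR f η) K ξ u) =
      f (x - u + η) • (opB (sixVertexR f η) K ξ u * opD (sixVertexR f η) K ξ x) := by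
    simpa [opA, opB, opD] using (satisfiesRTT_monodromy hf hK ξ x u).apply 1 0 1 1
  have h' := congrArg (fun X => w ᵥ* X) h
  simp only [vecMul_add, vecMul_smul, ← vecMul_vecMul, hx, zero_vecMul, smul_zero, add_zero,
    hw u, smul_vecMul] at h'
  rw [show x - u = -(u - x) by ring, show -(u - x) + η = -(u - x - η) by ring, hf.odd, hf.odd,
    neg_smul, neg_smul, neg_inj] at h'
  rw [h', smul_smul, smul_smul]
  congr 1
  ring

/-- The operator `A x` does not annihilate a non-zero covector annihilated by `B x`, as long as
the quantum determinant does not vanish at `x`. -/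
theorem vecMul_opA_ne_zero (hf : IsSixVertexFunction f) (hK : K 0 1 ≠ 0) {x : ℂ}
    (hx : ∀ n, f (x - ξ n + η) * f (x - ξ n - η) ≠ 0) (hw : w ≠ 0)
    (hwB : w ᵥ* opB (sixVertexR f η) K ξ x = 0) : w ᵥ* opA (sixVertexR f η) K ξ x ≠ 0 := by
  intro hwA
  set l := (List.finRange N).reverse
  set P' := laxProd (fun n => sixVertexR f η (x - ξ n - η)) l
  have hq := laxProd_mul_quantumAdjugate
    (fun n => hf.localLax_mul_quantumAdjugate η (x - ξ n))
    (List.nodup_reverse.2 (List.nodup_finRange N))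
  have h : monodromy (sixVertexR f η) K ξ x * quantumAdjugate P' =
      K.map (algebraMap ℂ (Op N)) *
        algebraMap ℂ _ ((l.map fun n => f (x - ξ n + η) * f (x - ξ n - η)).prod) := by
    rw [monodromy_eq, mul_assoc, hq]
  -- the upper right entry: the row `(A x, B x)` times the quantum adjugate
  have h01 : opA (sixVertexR f η) K ξ x * quantumAdjugate P' 0 1 +
      opB (sixVertexR f η) K ξ x * quantumAdjugate P' 1 1 =
      algebraMap ℂ (Op N)
        (K 0 1 * (l.map fun n => f (x - ξ n + η) * f (x - ξ n - η)).prod) := by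
    have := congrFun (congrFun h 0) 1
    simpa [mul_apply, Fin.sum_univ_two, algebraMap_matrix_apply, opA, opB] using this
  have h' := congrArg (fun X => w ᵥ* X) h01
  simp only [vecMul_add, ← vecMul_vecMul, hwA, hwB, zero_vecMul, add_zero,
    Algebra.algebraMap_eq_smul_one, vecMul_smul, vecMul_one] at h'
  refine smul_ne_zero (mul_ne_zero hK (List.prod_ne_zero ?_)) hw h'.symm
  rw [List.mem_map]
  rintro ⟨n, -, hn⟩
  exact hx n hn

end Monodromy

/-! ### Left eigenbases with simple spectrum -/

theorem linearIndependent_of_left_eigen {B : ℂ → Op N} {v : (Fin N → Fin 2) → Cov N}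
    {e : (Fin N → Fin 2) → ℂ → ℂ} (hB : ∀ h u, v h ᵥ* B u = e h u • v h) (hv : ∀ h, v h ≠ 0)
    {u : ℂ} (he : Function.Injective fun h => e h u) : LinearIndependent ℂ v :=
  Module.End.eigenvectors_linearIndependent' (vecMulLinear (B u)) _ he v fun h =>
    ⟨Module.End.mem_eigenspace_iff.2 (hB h u), hv h⟩

/-- Eigencovectors whose eigenvalues are distinct for some spectral parameter form a basis. -/
theorem isLeftEigenbasis_of_eigen {B : ℂ → Op N} {v : (Fin N → Fin 2) → Cov N}
    {e : (Fin N → Fin 2) → ℂ → ℂ} (hB : ∀ h u, v h ᵥ* B u = e h u • v h) (hv : ∀ h, v h ≠ 0)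
    (he : ∀ᶠ u in codiscrete ℂ, Function.Injective fun h => e h u) : IsLeftEigenbasis B v e := by
  have hne : ∃ u, Function.Injective fun h => e h u := by
    have h0 := mem_codiscrete.1 he 0
    rw [disjoint_principal_right, compl_compl] at h0
    exact Eventually.exists (f := nhdsWithin (0 : ℂ) {0}ᶜ) h0
  obtain ⟨u, hu⟩ := hne
  have hli := linearIndependent_of_left_eigen hB hv hu
  exact ⟨hB, hli, hli.span_eq_top_of_card_eq_finrank' (by simp)⟩

namespace IsLeftEigenbasis

variable {B : ℂ → Op N} {v : (Fin N → Fin 2) → Cov N} {e : (Fin N → Fin 2) → ℂ → ℂ}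

theorem diagonalizableSimple (hv : IsLeftEigenbasis B v e)
    (he : ∀ᶠ u in codiscrete ℂ, Function.Injective fun h => e h u) : DiagonalizableSimple B := by
  have hP : IsUnit (Matrix.of v : Op N) :=
    linearIndependent_rows_iff_isUnit.1 hv.linearIndependent
  refine ⟨Matrix.of v, fun u h => e h u, hP, fun u => ?_, he⟩
  have h : Matrix.of v * B u = diagonal (fun h => e h u) * Matrix.of v := by
    ext h s
    rw [diagonal_mul]
    exact congrFun (hv.eigen h u) s
  rw [h, mul_assoc, mul_nonsing_inv _ ((isUnit_iff_isUnit_det _).1 hP), mul_one]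

theorem conj (hv : IsLeftEigenbasis B v e) {W : Op N} (hW : IsUnit W) :
    IsLeftEigenbasis (fun u => W * B u * W⁻¹) (fun h => v h ᵥ* W⁻¹) e := by
  have hdet := (isUnit_iff_isUnit_det _).1 hW
  have hinj : Function.Injective (vecMulLinear W⁻¹ : Cov N →ₗ[ℂ] Cov N) :=
    Function.LeftInverse.injective (g := fun x => x ᵥ* W) fun x => by
      simp [vecMul_vecMul, nonsing_inv_mul _ hdet]
  have hli : LinearIndependent ℂ (fun h => v h ᵥ* W⁻¹) :=
    hv.linearIndependent.map' (vecMulLinear W⁻¹) (LinearMap.ker_eq_bot.2 hinj)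
  refine ⟨fun h u => ?_, hli, hli.span_eq_top_of_card_eq_finrank' (by simp)⟩
  rw [vecMul_vecMul, ← mul_assoc, ← mul_assoc, nonsing_inv_mul _ hdet, one_mul, ← vecMul_vecMul,
    hv.eigen, smul_vecMul]

/-- A joint eigencovector whose eigenvalue is not in the joint spectrum vanishes. -/
theorem eq_zero_of_eigen (hv : IsLeftEigenbasis B v e) {w : Cov N} {γ : ℂ → ℂ}
    (hw : ∀ u, w ᵥ* B u = γ u • w) (hγ : ∀ h, ∃ u, e h u ≠ γ u) : w = 0 := by
  let b := Module.Basis.mk hv.linearIndependent hv.span_eq_top.ge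
  have hb : ∀ h, b h = v h := fun h => Module.Basis.mk_apply _ _ h
  refine b.repr.map_eq_zero_iff.1 (Finsupp.ext fun h => ?_)
  obtain ⟨u, hu⟩ := hγ h
  have hs : w ᵥ* B u = ∑ k, (b.repr w k * e k u) • b k := by
    conv_lhs => rw [← b.sum_repr w]
    rw [← vecMulLinear_apply, map_sum]
    refine Finset.sum_congr rfl fun k _ => ?_
    rw [vecMulLinear_apply, smul_vecMul, hb, hv.eigen, smul_smul]
  have h1 := congrArg (fun x => b.repr x h) (hs.symm.trans (hw u))
  simp only [b.repr_sum_self, map_smul, Finsupp.smul_apply, smul_eq_mul] at h1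
  by_contra h0
  exact hu (mul_left_cancel₀ h0 (h1.trans (mul_comm _ _)))

end IsLeftEigenbasis

/-! ### The spectrum of `B` -/

/-- The eigenvalues `κ ∏ₙ f (u - ξₙ + hₙ η)` of the operators `B u`. -/
noncomputable def eigB (f : ℂ → ℂ) (η κ : ℂ) (ξ : Fin N → ℂ) (h : Fin N → Fin 2) (u : ℂ) : ℂ :=
  κ * ∏ n, f (u - ξ n + ((h n : ℕ) : ℂ) * η)

/-- The inhomogeneities are in general position: no `f (ξₐ - ξ_b + r η)` vanishes for `a ≠ b` and
`r ∈ {-1, 0, 1}`. For odd `f` the case `r = -1` follows from `r = 1` with `a` and `b`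
exchanged. -/
structure IsGeneric (f : ℂ → ℂ) (η : ℂ) (ξ : Fin N → ℂ) : Prop where
  eta : f η ≠ 0
  sub : ∀ a b, a ≠ b → f (ξ a - ξ b) ≠ 0
  sub_add : ∀ a b, a ≠ b → f (ξ a - ξ b + η) ≠ 0

variable {f : ℂ → ℂ} {η κ : ℂ} {ξ : Fin N → ℂ}

theorem IsGeneric.add_mul_ne_zero (hξ : IsGeneric f η ξ) {a b : Fin N} (hab : a ≠ b) (i : Fin 2) :
    f (ξ a - ξ b + ((i : ℕ) : ℂ) * η) ≠ 0 := by
  fin_cases i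
  · simpa using hξ.sub a b hab
  · simpa using hξ.sub_add a b hab

theorem IsGeneric.sub_sub_ne_zero (hf : IsSixVertexFunction f) (hξ : IsGeneric f η ξ)
    (a b : Fin N) : f (ξ a - ξ b - η) ≠ 0 := by
  rw [show ξ a - ξ b - η = -(ξ b - ξ a + η) by ring, hf.odd, neg_ne_zero]
  rcases eq_or_ne b a with rfl | h
  · simpa using hξ.eta
  · exact hξ.sub_add b a h

theorem IsGeneric.prod_erase_ne_zero (hξ : IsGeneric f η ξ) (h : Fin N → Fin 2) (n : Fin N) :
    ∏ m ∈ Finset.univ.erase n, f (ξ n - ξ m + ((h m : ℕ) : ℂ) * η) ≠ 0 :=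
  Finset.prod_ne_zero_iff.2 fun _ hm => hξ.add_mul_ne_zero (Finset.ne_of_mem_erase hm).symm _

theorem eigB_eq_mul (f : ℂ → ℂ) (η κ : ℂ) (ξ : Fin N → ℂ) (h : Fin N → Fin 2) (n : Fin N) (u : ℂ) :
    eigB f η κ ξ h u = f (u - ξ n + ((h n : ℕ) : ℂ) * η) *
      (κ * ∏ m ∈ Finset.univ.erase n, f (u - ξ m + ((h m : ℕ) : ℂ) * η)) := by
  rw [eigB, ← Finset.mul_prod_erase _ _ (Finset.mem_univ n)]
  ring

theorem eigB_eq_mul_of_eq_zero (f : ℂ → ℂ) (η κ : ℂ) (ξ : Fin N → ℂ) {h : Fin N → Fin 2}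
    {n : Fin N} (hn : h n = 0) (u : ℂ) :
    eigB f η κ ξ h u = f (u - ξ n) *
      (κ * ∏ m ∈ Finset.univ.erase n, f (u - ξ m + ((h m : ℕ) : ℂ) * η)) := by
  rw [eigB_eq_mul f η κ ξ h n, hn]
  simp

/-- The eigenvalue at `ξₙ` detects the quantum number `hₙ`. -/
theorem eigB_apply_eq_zero_iff (hf : IsSixVertexFunction f) (hξ : IsGeneric f η ξ) (hκ : κ ≠ 0)
    (h : Fin N → Fin 2) (n : Fin N) : eigB f η κ ξ h (ξ n) = 0 ↔ h n = 0 := by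
  rw [eigB_eq_mul f η κ ξ h n, mul_eq_zero,
    or_iff_left (mul_ne_zero hκ (hξ.prod_erase_ne_zero h n)), sub_self, zero_add]
  generalize h n = i
  fin_cases i
  · simpa using hf.map_zero
  · simpa using hξ.eta

theorem eventually_injective_eigB (hf : IsSixVertexFunction f) (hξ : IsGeneric f η ξ)
    (hκ : κ ≠ 0) :
    ∀ᶠ u in codiscrete ℂ, Function.Injective fun h => eigB f η κ ξ h u := by
  have hd : ∀ h, Differentiable ℂ (eigB f η κ ξ h) := fun h => by
    have := hf.differentiable
    unfold eigB
    refine (Differentiable.fun_finsetProd fun n _ => ?_).const_mul κ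
    exact this.comp ((differentiable_id.sub_const _).add_const _)
  have key : ∀ h h', ∀ᶠ u in codiscrete ℂ, eigB f η κ ξ h u = eigB f η κ ξ h' u → h = h' := by
    intro h h'
    by_cases hh : h = h'
    · exact Eventually.of_forall fun _ _ => hh
    obtain ⟨n, hn⟩ := Function.ne_iff.1 hh
    have hne : eigB f η κ ξ h (ξ n) - eigB f η κ ξ h' (ξ n) ≠ 0 := by
      intro h0
      have h1 := eigB_apply_eq_zero_iff hf hξ hκ h n
      rw [sub_eq_zero.1 h0, eigB_apply_eq_zero_iff hf hξ hκ h' n] at h1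
      omega
    have ha : AnalyticOnNhd ℂ (fun u => eigB f η κ ξ h u - eigB f η κ ξ h' u) Set.univ :=
      fun z _ => ((hd h).sub (hd h')).analyticAt z
    filter_upwards [ha.preimage_zero_mem_codiscrete hne] with u hu he
    exact absurd (sub_eq_zero.2 he) hu
  filter_upwards [eventually_all.2 fun h => eventually_all.2 (key h)] with u hu h h' he
  exact hu h h' he

/-- The function obtained from an eigenvalue by moving its zero `ξₙ` to `ξₙ + η` is not an
eigenvalue. -/
theorem exists_eigB_ne (hf : IsSixVertexFunction f) (hξ : IsGeneric f η ξ) (hκ : κ ≠ 0)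
    (h h' : Fin N → Fin 2) (n : Fin N) :
    ∃ u, eigB f η κ ξ h' u ≠ f (u - ξ n - η) *
      (κ * ∏ m ∈ Finset.univ.erase n, f (u - ξ m + ((h m : ℕ) : ℂ) * η)) := by
  by_contra! H
  -- away from the site `n`, the zeros at the inhomogeneities force `h' m = h m`
  have hm : ∀ m ∈ Finset.univ.erase n, h' m = h m := by
    intro m hm
    have hmn := Finset.ne_of_mem_erase hm
    have h1 := eigB_apply_eq_zero_iff hf hξ hκ h' m
    have h2 := eigB_apply_eq_zero_iff hf hξ hκ h m
    rw [H, mul_eq_zero, or_iff_right (hξ.sub_sub_ne_zero hf m n)] at h1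
    rw [eigB_eq_mul f η κ ξ h n, mul_eq_zero, or_iff_right (hξ.add_mul_ne_zero hmn _)] at h2
    have h3 := h1.symm.trans h2
    omega
  have h1 := H (ξ n)
  rw [eigB_eq_mul f η κ ξ h' n, Finset.prod_congr rfl fun m hm' => by rw [hm m hm']] at h1
  have h2 := mul_right_cancel₀ (mul_ne_zero hκ (hξ.prod_erase_ne_zero h n)) h1
  rw [sub_self, zero_add, zero_sub, hf.odd] at h2
  -- at `ξ n` the identity reads `f (h' n * η) = -f η`, impossible for both values of `h' n`
  generalize h' n = i at h2
  have hη := hξ.eta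
  fin_cases i
  · simp [hf.map_zero, hη] at h2
  · simp only [Nat.cast_one, one_mul] at h2
    exact hη (by linear_combination h2 / 2)

/-! ### The separation of variables bases -/

/-- The covector `⟨S| ∏ₙ (Xₙ / cₙ)^{hₙ}`, with the product over the sites of a list. -/
noncomputable def partialSovCov (S : Cov N) (X : Fin N → Op N) (c : Fin N → ℂ)
    (h : Fin N → Fin 2) (l : List (Fin N)) : Cov N :=
  S ᵥ* (l.map fun n => ((c n)⁻¹ • X n) ^ (h n : ℕ)).prod

theorem sovCov_eq_partialSovCov (S : Cov N) (X : Fin N → Op N) (c : Fin N → ℂ)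
    (h : Fin N → Fin 2) : sovCov S X c h = partialSovCov S X c h (List.finRange N) := by
  rw [sovCov, partialSovCov, List.ofFn_eq_map]

theorem partialSovCov_append (S : Cov N) (X : Fin N → Op N) (c : Fin N → ℂ) (h : Fin N → Fin 2)
    (l : List (Fin N)) (n : Fin N) :
    partialSovCov S X c h (l ++ [n]) =
      partialSovCov S X c h l ᵥ* ((c n)⁻¹ • X n) ^ (h n : ℕ) := by
  simp [partialSovCov, vecMul_vecMul]

/-- The quantum numbers `h`, put to zero outside a list of sites. -/
def restrictTo (h : Fin N → Fin 2) (l : List (Fin N)) : Fin N → Fin 2 :=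
  fun m => if m ∈ l then h m else 0

theorem restrictTo_apply_of_notMem (h : Fin N → Fin 2) {l : List (Fin N)} {n : Fin N}
    (hn : n ∉ l) : restrictTo h l n = 0 := if_neg hn

theorem restrictTo_append_of_eq_zero {h : Fin N → Fin 2} (l : List (Fin N)) {n : Fin N}
    (hn : h n = 0) : restrictTo h (l ++ [n]) = restrictTo h l := by
  funext m
  rcases eq_or_ne m n with rfl | hm
  · simp [restrictTo, hn]
  · simp [restrictTo, hm]

theorem restrictTo_append_apply_of_ne (h : Fin N → Fin 2) (l : List (Fin N)) {m n : Fin N}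
    (hm : m ≠ n) : restrictTo h (l ++ [n]) m = restrictTo h l m := by
  simp [restrictTo, hm]

theorem restrictTo_append_self (h : Fin N → Fin 2) (l : List (Fin N)) (n : Fin N) :
    restrictTo h (l ++ [n]) n = h n := by
  simp [restrictTo]

theorem restrictTo_finRange (h : Fin N → Fin 2) : restrictTo h (List.finRange N) = h := by
  funext m
  simp [restrictTo]

variable {K : Matrix (Fin 2) (Fin 2) ℂ}

theorem refCov_ne_zero : refCov N ≠ 0 := fun h => by
  have := congrFun h fun _ => 0
  simp [refCov] at this

/-- The reference covector is a joint eigencovector for operators at one site that act on `(1, 0)`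
by scalars. -/
theorem refCov_vecMul_siteOp {X : Matrix (Fin 2) (Fin 2) ℂ} {x : ℂ} (h0 : X 0 0 = x)
    (h1 : X 0 1 = 0) (n : Fin N) : refCov N ᵥ* siteOp n X = x • refCov N := by
  have hX : (![1, 0] : Fin 2 → ℂ) ᵥ* X = x • ![1, 0] := by
    ext i
    fin_cases i <;> simp [vecMul, dotProduct, h0, h1]
  rw [siteOp_eq_productOp]
  ext t
  have hsum : ∀ m, ∑ s : Fin 2, (![1, 0] : Fin 2 → ℂ) s *
      Function.update (1 : Fin N → Matrix (Fin 2) (Fin 2) ℂ) n X m s (t m) =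
        (if m = n then x else 1) * (![1, 0] : Fin 2 → ℂ) (t m) := by
    intro m
    rcases eq_or_ne m n with rfl | hm
    · simpa [vecMul, dotProduct] using congrFun hX (t m)
    · rw [Function.update_of_ne hm]
      simpa [hm, vecMul, dotProduct] using congrFun (vecMul_one (![1, 0] : Fin 2 → ℂ)) (t m)
  simp only [vecMul, dotProduct, refCov, productOp, of_apply, ← Finset.prod_mul_distrib,
    Pi.smul_apply, smul_eq_mul]
  rw [← Fintype.prod_sum fun m s => (![1, 0] : Fin 2 → ℂ) s *
    Function.update (1 : Fin N → Matrix (Fin 2) (Fin 2) ℂ) n X m s (t m)]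
  simp only [hsum]
  rw [Finset.prod_mul_distrib, Finset.prod_ite_eq' Finset.univ n]
  simp

theorem refCov_vecMul_laxProd (v : Fin N → ℂ) {l : List (Fin N)} (hl : l.Nodup) :
    refCov N ᵥ* laxProd (fun n => sixVertexR f η (v n)) l 0 1 = 0 ∧
      refCov N ᵥ* laxProd (fun n => sixVertexR f η (v n)) l 1 1 =
        (l.map fun n => f (v n)).prod • refCov N := by
  induction l with
  | nil => simp [laxProd]
  | cons n l ih =>
    rw [List.nodup_cons] at hl
    obtain ⟨ih0, ih1⟩ := ih hl.2
    have h01 : refCov N ᵥ* laxOp (sixVertexR f η (v n)) n 0 1 = (0 : ℂ) • refCov N :=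
      refCov_vecMul_siteOp (by simp [sixVertexR, sixVertex_apply])
        (by simp [sixVertexR, sixVertex_apply]) n
    have h00 : refCov N ᵥ* laxOp (sixVertexR f η (v n)) n 0 0 = f (v n + η) • refCov N :=
      refCov_vecMul_siteOp (by simp [sixVertexR, sixVertex_apply])
        (by simp [sixVertexR, sixVertex_apply]) n
    have h11 : refCov N ᵥ* laxOp (sixVertexR f η (v n)) n 1 1 = f (v n) • refCov N :=
      refCov_vecMul_siteOp (by simp [sixVertexR, sixVertex_apply])
        (by simp [sixVertexR, sixVertex_apply]) n
    -- `⟨0|` is not an eigencovector of the lower left entry at `n`, so move that entry to the right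
    have hc := entriesCommute_laxProd (R := sixVertexR f η (v n)) (fun n => sixVertexR f η (v n))
      hl.1 1 0 0 1
    rw [laxProd_cons, mul_apply, mul_apply, Fin.sum_univ_two, Fin.sum_univ_two, hc.eq]
    simp only [vecMul_add, ← vecMul_vecMul, h00, h01, h11, ih0, ih1, smul_vecMul, zero_smul,
      zero_vecMul, smul_zero, add_zero, zero_add, List.map_cons, List.prod_cons, smul_smul,
      and_self]

theorem refCov_vecMul_opB (u : ℂ) :
    refCov N ᵥ* opB (sixVertexR f η) K ξ u = eigB f η (K 0 1) ξ 0 u • refCov N := by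
  obtain ⟨h0, h1⟩ := refCov_vecMul_laxProd (f := f) (η := η) (fun n => u - ξ n)
    (List.nodup_reverse.2 (List.nodup_finRange N))
  rw [opB, monodromy_eq, mul_apply, Fin.sum_univ_two, vecMul_add, Matrix.map_apply,
    Matrix.map_apply, ← Algebra.smul_def, ← Algebra.smul_def, vecMul_smul, vecMul_smul, h0, h1,
    smul_zero, zero_add, smul_smul, List.map_reverse, List.prod_reverse, eigB,
    ← List.ofFn_eq_map, List.prod_ofFn]
  simp

/-- Sklyanin's construction: each factor `A (ξₙ)` moves the zero `ξₙ` of the eigenvalue of `B` to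
`ξₙ - η`, starting from the reference covector. -/
theorem partialSovCov_eigen (hf : IsSixVertexFunction f) (hξ : IsGeneric f η ξ)
    (hK : ∀ u, SatisfiesRTT (sixVertexR f η u) K K) (hb : K 0 1 ≠ 0) {c : Fin N → ℂ}
    (hc : ∀ n, c n ≠ 0) (h : Fin N → Fin 2) {l : List (Fin N)} (hl : l.Nodup) :
    (∀ u, partialSovCov (refCov N) (fun n => opA (sixVertexR f η) K ξ (ξ n)) c h l ᵥ*
        opB (sixVertexR f η) K ξ u = eigB f η (K 0 1) ξ (restrictTo h l) u •
          partialSovCov (refCov N) (fun n => opA (sixVertexR f η) K ξ (ξ n)) c h l) ∧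
      partialSovCov (refCov N) (fun n => opA (sixVertexR f η) K ξ (ξ n)) c h l ≠ 0 := by
  induction l using List.reverseRecOn with
  | nil =>
    have h0 : restrictTo h ([] : List (Fin N)) = 0 := by funext m; simp [restrictTo]
    simpa [partialSovCov, h0] using ⟨refCov_vecMul_opB, refCov_ne_zero⟩
  | append_singleton l n ih =>
    obtain ⟨hn, hl⟩ : n ∉ l ∧ l.Nodup := List.nodup_cons.1 (by simpa using List.nodup_middle.1 hl)
    obtain ⟨ihB, ih0⟩ := ih hl
    rw [partialSovCov_append]
    set w := partialSovCov (refCov N) (fun n => opA (sixVertexR f η) K ξ (ξ n)) c h l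
    rcases (by omega : h n = 0 ∨ h n = 1) with h0 | h1
    · rw [restrictTo_append_of_eq_zero l h0, h0]
      simpa using ⟨ihB, ih0⟩
    · have hr := restrictTo_apply_of_notMem h hn
      have hcont := hf.differentiable.continuous
      have hw := ihB
      simp only [eigB_eq_mul_of_eq_zero f η (K 0 1) ξ hr] at hw
      have hA := vecMul_opA_vecMul_opB hf hξ.eta hK (by fun_prop) hw
      rw [h1, Fin.val_one, pow_one, vecMul_smul]
      refine ⟨fun u => ?_, smul_ne_zero (inv_ne_zero (hc n)) ?_⟩
      · have hprod : ∏ m ∈ Finset.univ.erase n,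
            f (u - ξ m + ((restrictTo h (l ++ [n]) m : ℕ) : ℂ) * η) =
              ∏ m ∈ Finset.univ.erase n, f (u - ξ m + ((restrictTo h l m : ℕ) : ℂ) * η) :=
          Finset.prod_congr rfl fun m hm => by
            rw [restrictTo_append_apply_of_ne h l (Finset.ne_of_mem_erase hm)]
        rw [smul_vecMul, hA, smul_comm, eigB_eq_mul f η (K 0 1) ξ _ n, restrictTo_append_self, h1,
          hprod]
        simp
      · refine vecMul_opA_ne_zero hf hb (fun m => mul_ne_zero ?_ (hξ.sub_sub_ne_zero hf n m)) ih0 ?_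
        · rcases eq_or_ne n m with rfl | hnm
          · simpa using hξ.eta
          · exact hξ.sub_add n m hnm
        · rw [hw, sub_self, hf.map_zero]
          simp

theorem isLeftEigenbasis_sovCov (hf : IsSixVertexFunction f) (hξ : IsGeneric f η ξ)
    (hK : ∀ u, SatisfiesRTT (sixVertexR f η u) K K) (hb : K 0 1 ≠ 0) {c : Fin N → ℂ}
    (hc : ∀ n, c n ≠ 0) :
    IsLeftEigenbasis (opB (sixVertexR f η) K ξ)
      (sovCov (refCov N) (fun n => opA (sixVertexR f η) K ξ (ξ n)) c)
      (eigB f η (K 0 1) ξ) := by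
  have key := fun h => partialSovCov_eigen hf hξ hK hb hc h (List.nodup_finRange N)
  simp only [← sovCov_eq_partialSovCov, restrictTo_finRange] at key
  exact isLeftEigenbasis_of_eigen (fun h => (key h).1) (fun h => (key h).2)
    (eventually_injective_eigB hf hξ hb)

/-- Acting with transfer matrices on the reference covector gives Sklyanin's basis, because each
`D (ξₙ)` would move a zero of the eigenvalue of `B` out of the spectrum, and so acts by zero. -/
theorem partialSovCov_transfer (hf : IsSixVertexFunction f) (hξ : IsGeneric f η ξ)
    (hK : ∀ u, SatisfiesRTT (sixVertexR f η u) K K) (hb : K 0 1 ≠ 0) {c : Fin N → ℂ}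
    (hc : ∀ n, c n ≠ 0) (h : Fin N → Fin 2) {l : List (Fin N)} (hl : l.Nodup) :
    partialSovCov (refCov N) (fun n => transfer (sixVertexR f η) K ξ (ξ n)) c h l =
      partialSovCov (refCov N) (fun n => opA (sixVertexR f η) K ξ (ξ n)) c h l := by
  induction l using List.reverseRecOn with
  | nil => rfl
  | append_singleton l n ih =>
    obtain ⟨hn, hl⟩ : n ∉ l ∧ l.Nodup := List.nodup_cons.1 (by simpa using List.nodup_middle.1 hl)
    rw [partialSovCov_append, partialSovCov_append, ih hl]
    rcases (by omega : h n = 0 ∨ h n = 1) with h0 | h1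
    · rw [h0, Fin.val_zero, pow_zero, pow_zero]
    · have hcont := hf.differentiable.continuous
      have hw := (partialSovCov_eigen hf hξ hK hb hc h hl).1
      simp only [eigB_eq_mul_of_eq_zero f η (K 0 1) ξ (restrictTo_apply_of_notMem h hn)] at hw
      have hD := (isLeftEigenbasis_sovCov hf hξ hK hb hc).eq_zero_of_eigen
        (vecMul_opD_vecMul_opB hf hξ.eta hK (by fun_prop) hw)
        fun h' => exists_eigB_ne hf hξ hb (restrictTo h l) h' n
      have hT : transfer (sixVertexR f η) K ξ (ξ n) =
          opA (sixVertexR f η) K ξ (ξ n) + opD (sixVertexR f η) K ξ (ξ n) := trace_fin_two _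
      rw [h1, Fin.val_one, pow_one, pow_one, vecMul_smul, vecMul_smul, hT, vecMul_add, hD, add_zero]

theorem sovCov_transfer (hf : IsSixVertexFunction f) (hξ : IsGeneric f η ξ)
    (hK : ∀ u, SatisfiesRTT (sixVertexR f η u) K K) (hb : K 0 1 ≠ 0) {c : Fin N → ℂ}
    (hc : ∀ n, c n ≠ 0) (h : Fin N → Fin 2) :
    sovCov (refCov N) (fun n => transfer (sixVertexR f η) K ξ (ξ n)) c h =
      sovCov (refCov N) (fun n => opA (sixVertexR f η) K ξ (ξ n)) c h := by
  rw [sovCov_eq_partialSovCov, sovCov_eq_partialSovCov,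
    partialSovCov_transfer hf hξ hK hb hc h (List.nodup_finRange N)]

theorem IsGeneric.commute_opA (hf : IsSixVertexFunction f) (hξ : IsGeneric f η ξ)
    (hK : ∀ u, SatisfiesRTT (sixVertexR f η u) K K) (a b : Fin N) :
    Commute (opA (sixVertexR f η) K ξ (ξ a)) (opA (sixVertexR f η) K ξ (ξ b)) := by
  rcases eq_or_ne a b with rfl | hab
  · exact Commute.refl _
  · exact SoV.commute_opA hf hK (hξ.sub_add a b hab)

theorem IsGeneric.commute_transfer (hf : IsSixVertexFunction f) (hξ : IsGeneric f η ξ)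
    (hK : ∀ u, SatisfiesRTT (sixVertexR f η u) K K) (a b : Fin N) :
    Commute (transfer (sixVertexR f η) K ξ (ξ a)) (transfer (sixVertexR f η) K ξ (ξ b)) := by
  rcases eq_or_ne a b with rfl | hab
  · exact Commute.refl _
  · exact SoV.commute_transfer hf hK (hξ.sub_add a b hab) (hξ.sub_add b a hab.symm)

theorem IsGeneric.prod_ne_zero (hξ : IsGeneric f η ξ) (n : Fin N) :
    ∏ m, f (ξ n - ξ m + η) ≠ 0 := by
  refine Finset.prod_ne_zero_iff.2 fun m _ => ?_
  rcases eq_or_ne n m with rfl | hnm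
  · simpa using hξ.eta
  · exact hξ.sub_add n m hnm

/-! ### The two models -/

theorem satisfiesRTT_antidiagTwist (f : ℂ → ℂ) (η α u : ℂ) :
    SatisfiesRTT (sixVertexR f η u) (antidiagTwist α) (antidiagTwist α) := by
  refine satisfiesRTT_of_apply fun i p j q => ?_
  fin_cases i <;> fin_cases p <;> fin_cases j <;> fin_cases q <;> 
    simp [antidiagTwist, -mul_eq_mul_left_iff, -mul_eq_mul_right_iff] <;> ring

theorem satisfiesRTT_id (η u : ℂ) (K : Matrix (Fin 2) (Fin 2) ℂ) :
    SatisfiesRTT (sixVertexR id η u) K K := by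
  refine satisfiesRTT_of_apply fun i p j q => ?_
  fin_cases i <;> fin_cases p <;> fin_cases j <;> fin_cases q <;>
    simp [-mul_eq_mul_left_iff, -mul_eq_mul_right_iff] <;> ring

/-- The entries of the monodromy matrix with antidiagonal twist are those of the untwisted one,
with the rows exchanged. -/
theorem monodromy_antidiagTwist (R : ℂ → Matrix (Fin 2 × Fin 2) (Fin 2 × Fin 2) ℂ) (α : ℂ)
    (ξ : Fin N → ℂ) (u : ℂ) (j : Fin 2) :
    monodromy R (antidiagTwist α) ξ u 0 j = Complex.exp α • monodromy R 1 ξ u 1 j ∧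
      monodromy R (antidiagTwist α) ξ u 1 j = Complex.exp (-α) • monodromy R 1 ξ u 0 j := by
  simp [monodromy_eq, mul_apply, Fin.sum_univ_two, antidiagTwist, Algebra.smul_def]

theorem sinh_ne_zero_of_forall_ne {z : ℂ} (h : ∀ m : ℤ, z ≠ Complex.I * m * Real.pi) :
    Complex.sinh z ≠ 0 := by
  intro hz
  have h1 : Complex.sin (z * Complex.I) = 0 := by rw [Complex.sin_mul_I, hz, zero_mul]
  obtain ⟨k, hk⟩ := Complex.sin_eq_zero_iff.1 h1
  refine h (-k) ?_
  push_cast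
  linear_combination -Complex.I * hk + z * Complex.I_sq

theorem isGeneric_sinh {ξ : Fin N → ℂ} (hη : Complex.sinh η ≠ 0)
    (hξ : ∀ a b, a ≠ b → ∀ r ∈ ({-1, 0, 1} : Set ℤ), ∀ m : ℤ,
      ξ a ≠ ξ b + r * η + Complex.I * m * Real.pi) : IsGeneric Complex.sinh η ξ where
  eta := hη
  sub a b hab := sinh_ne_zero_of_forall_ne fun m hm =>
    hξ a b hab 0 (by simp) m (by push_cast; linear_combination hm)
  sub_add a b hab := sinh_ne_zero_of_forall_ne fun m hm =>
    hξ a b hab (-1) (by simp) m (by push_cast; linear_combination hm)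

theorem isGeneric_id {ξ : Fin N → ℂ} (hη : η ≠ 0)
    (hξ : ∀ a b, a ≠ b → ∀ r ∈ ({-1, 0, 1} : Set ℤ), ξ a ≠ ξ b + r * η) : IsGeneric id η ξ where
  eta := hη
  sub a b hab h := hξ a b hab 0 (by simp) (by push_cast; simp only [id] at h; linear_combination h)
  sub_add a b hab h :=
    hξ a b hab (-1) (by simp) (by push_cast; simp only [id] at h; linear_combination h)

/-! ### Gauge transformations of the rational model -/

theorem exists_isUnit_conj_apply_ne_zero {K : Matrix (Fin 2) (Fin 2) ℂ}
    (hK : ∀ c : ℂ, K ≠ c • (1 : Matrix (Fin 2) (Fin 2) ℂ)) :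
    ∃ W : Matrix (Fin 2) (Fin 2) ℂ, IsUnit W ∧ (W⁻¹ * K * W) 0 1 ≠ 0 := by
  by_cases h01 : K 0 1 = 0
  · by_cases h10 : K 1 0 = 0
    · have hne : K 0 0 ≠ K 1 1 := fun h => hK (K 0 0) (by
        ext i j
        fin_cases i <;> fin_cases j <;> simp [h01, h10, h])
      have hu : (!![1, 1; 0, 1] : Matrix (Fin 2) (Fin 2) ℂ)⁻¹ = !![1, -1; 0, 1] :=
        inv_eq_right_inv (by simp [one_fin_two])
      refine ⟨!![1, 1; 0, 1], by simp [isUnit_iff_isUnit_det], ?_⟩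
      rw [hu]
      simpa [mul_apply, Fin.sum_univ_two, vecMul, dotProduct, h01, h10, ← sub_eq_add_neg,
        sub_eq_zero] using hne
    · have hu : (!![0, 1; 1, 0] : Matrix (Fin 2) (Fin 2) ℂ)⁻¹ = !![0, 1; 1, 0] :=
        inv_eq_right_inv (by simp [one_fin_two])
      refine ⟨!![0, 1; 1, 0], by simp [isUnit_iff_isUnit_det], ?_⟩
      rw [hu]
      simpa [mul_apply, Fin.sum_univ_two, vecMul, dotProduct] using h10
  · exact ⟨1, isUnit_one, by simpa using h01⟩

/-- Conjugating the twist by `W` amounts to conjugating the transfer matrix by `W^{⊗ N}`. -/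
theorem transfer_rationalR_conj (η : ℂ) (K : Matrix (Fin 2) (Fin 2) ℂ) (ξ : Fin N → ℂ)
    {W : Matrix (Fin 2) (Fin 2) ℂ} (hW : IsUnit W) (u : ℂ) :
    transfer (rationalR η) K ξ u =
      tensorOp N W * transfer (rationalR η) (W⁻¹ * K * W) ξ u * (tensorOp N W)⁻¹ := by
  have hdet := (isUnit_iff_isUnit_det _).1 hW
  have hT := (isUnit_iff_isUnit_det _).1 (isUnit_tensorOp (N := N) hW)
  set P := laxProd (fun n => rationalR η (u - ξ n)) (List.finRange N).reverse with hP
  set D : Matrix (Fin 2) (Fin 2) (Op N) := diagonal fun _ => tensorOp N W with hD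
  set ι : Matrix (Fin 2) (Fin 2) ℂ → Matrix (Fin 2) (Fin 2) (Op N) :=
    fun X => X.map (algebraMap ℂ (Op N)) with hι
  have ι_mul : ∀ X Y, ι (X * Y) = ι X * ι Y := fun X Y => Matrix.map_mul
  have hG : Commute (ι W * D) P :=
    Commute.list_prod_right _ _ fun x hx => by
      obtain ⟨n, -, rfl⟩ := List.mem_map.1 hx
      exact commute_laxOp_rationalR η _ W n
  have hDι : ∀ X : Matrix (Fin 2) (Fin 2) ℂ, D * ι X = ι X * D := fun X => by
    ext1 i j
    rw [hD, diagonal_mul, mul_diagonal]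
    exact (Algebra.commutes (X i j) (tensorOp N W)).symm
  have htr : ∀ X, (D * X).trace = tensorOp N W * X.trace ∧ (X * D).trace = X.trace * tensorOp N W :=
    fun X => by simp [hD, trace_fin_two, mul_add, add_mul]
  have htc : ∀ X Z, (ι X * Z).trace = (Z * ι X).trace := fun X Z =>
    (entriesCommute_algebraMap X Z).trace_mul_comm
  have key : tensorOp N W * (ι (W⁻¹ * K * W) * P).trace = (ι K * P).trace * tensorOp N W := by
    calc tensorOp N W * (ι (W⁻¹ * K * W) * P).trace
        = (ι (W⁻¹ * K) * (ι W * D * P)).trace := by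
          rw [← (htr _).1, ← mul_assoc, hDι, ι_mul]; simp only [mul_assoc]
      _ = (ι W⁻¹ * (ι K * P * ι W)).trace * tensorOp N W := by
          rw [hG.eq, ← (htr _).2, ι_mul]; simp only [mul_assoc]
      _ = (ι K * P).trace * tensorOp N W := by
          rw [htc, mul_assoc, ← ι_mul,
            mul_nonsing_inv _ hdet]
          simp [hι]
  simp only [transfer, monodromy_eq]
  change (ι K * P).trace = tensorOp N W * (ι (W⁻¹ * K * W) * P).trace * _
  rw [key, mul_assoc, mul_nonsing_inv _ hT, mul_one]

theorem sovCov_conj (S : Cov N) (X : Fin N → Op N) (c : Fin N → ℂ) (h : Fin N → Fin 2) {W : Op N}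
    (hW : IsUnit W) :
    sovCov (S ᵥ* W⁻¹) (fun n => W * X n * W⁻¹) c h = sovCov S X c h ᵥ* W⁻¹ := by
  have hdet := (isUnit_iff_isUnit_det _).1 hW
  rw [sovCov_eq_partialSovCov, sovCov_eq_partialSovCov]
  induction List.finRange N using List.reverseRecOn with
  | nil => simp [partialSovCov]
  | append_singleton l n ih =>
    rw [partialSovCov_append, partialSovCov_append, ih]
    rcases (by omega : h n = 0 ∨ h n = 1) with h0 | h1
    · simp [h0]
    · simp only [h1, Fin.val_one, pow_one, vecMul_smul, smul_vecMul, vecMul_vecMul]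
      rw [← mul_assoc, ← mul_assoc, nonsing_inv_mul _ hdet, one_mul]

end SoV

theorem mainTheorem11 :
    -- trigonometric case, antidiagonal twist
    (∀ (N : ℕ) (η α : ℂ) (ξ : Fin N → ℂ), Complex.sinh η ≠ 0 →
      (∀ a b, a ≠ b → ∀ r ∈ ({-1, 0, 1} : Set ℤ), ∀ m : ℤ,
        ξ a ≠ ξ b + r * η + Complex.I * m * Real.pi) →
      -- the entries of the twisted monodromy matrix in terms of those of the untwisted one
      (∀ u, opA (trigR η) (antidiagTwist α) ξ u = Complex.exp α • opC (trigR η) 1 ξ u ∧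
        opB (trigR η) (antidiagTwist α) ξ u = Complex.exp α • opD (trigR η) 1 ξ u ∧
        opC (trigR η) (antidiagTwist α) ξ u = Complex.exp (-α) • opA (trigR η) 1 ξ u ∧
        opD (trigR η) (antidiagTwist α) ξ u = Complex.exp (-α) • opB (trigR η) 1 ξ u) ∧
      -- the order of the factors in the products below does not matter
      (∀ a b, Commute (transfer (trigR η) (antidiagTwist α) ξ (ξ a))
        (transfer (trigR η) (antidiagTwist α) ξ (ξ b))) ∧
      (∀ a b, Commute (opA (trigR η) (antidiagTwist α) ξ (ξ a))
        (opA (trigR η) (antidiagTwist α) ξ (ξ b))) ∧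
      -- Sklyanin's basis
      IsLeftEigenbasis (opB (trigR η) (antidiagTwist α) ξ)
        (sovCov (refCov N) (fun n => opA (trigR η) (antidiagTwist α) ξ (ξ n))
          (fun n => Complex.I * trigA η ξ (ξ n)))
        (fun h u => Complex.exp α * ∏ n, Complex.sinh (u - ξ n + ((h n : ℕ) : ℂ) * η)) ∧
      DiagonalizableSimple (opB (trigR η) (antidiagTwist α) ξ) ∧
      -- coincidence of the two bases
      (∀ h, sovCov (refCov N) (fun n => transfer (trigR η) (antidiagTwist α) ξ (ξ n))
          (fun n => Complex.I * trigA η ξ (ξ n)) h =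
        sovCov (refCov N) (fun n => opA (trigR η) (antidiagTwist α) ξ (ξ n))
          (fun n => Complex.I * trigA η ξ (ξ n)) h)) ∧
    -- rational case
    (∀ (N : ℕ) (η : ℂ) (ξ : Fin N → ℂ), η ≠ 0 →
      (∀ a b, a ≠ b → ∀ r ∈ ({-1, 0, 1} : Set ℤ), ξ a ≠ ξ b + r * η) →
      -- twist with non-zero upper right entry
      (∀ K : Matrix (Fin 2) (Fin 2) ℂ, K 0 1 ≠ 0 →
        (∀ a b, Commute (transfer (rationalR η) K ξ (ξ a)) (transfer (rationalR η) K ξ (ξ b))) ∧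
        (∀ a b, Commute (opA (rationalR η) K ξ (ξ a)) (opA (rationalR η) K ξ (ξ b))) ∧
        IsLeftEigenbasis (opB (rationalR η) K ξ)
          (sovCov (refCov N) (fun n => opA (rationalR η) K ξ (ξ n))
            (fun n => rationalA η ξ (ξ n)))
          (fun h u => K 0 1 * ∏ n, (u - ξ n + ((h n : ℕ) : ℂ) * η)) ∧
        DiagonalizableSimple (opB (rationalR η) K ξ) ∧
        (∀ h, sovCov (refCov N) (fun n => transfer (rationalR η) K ξ (ξ n))
            (fun n => rationalA η ξ (ξ n)) h =
          sovCov (refCov N) (fun n => opA (rationalR η) K ξ (ξ n))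
            (fun n => rationalA η ξ (ξ n)) h)) ∧
      -- general twist, not proportional to the identity
      (∀ K : Matrix (Fin 2) (Fin 2) ℂ, (∀ c : ℂ, K ≠ c • (1 : Matrix (Fin 2) (Fin 2) ℂ)) →
        (∃ W : Matrix (Fin 2) (Fin 2) ℂ, IsUnit W ∧ (W⁻¹ * K * W) 0 1 ≠ 0) ∧
        (∀ a b, Commute (transfer (rationalR η) K ξ (ξ a)) (transfer (rationalR η) K ξ (ξ b))) ∧
        ∀ W : Matrix (Fin 2) (Fin 2) ℂ, IsUnit W → (W⁻¹ * K * W) 0 1 ≠ 0 →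
          IsUnit (tensorOp N W) ∧
          (∀ u, transfer (rationalR η) K ξ u =
            tensorOp N W * transfer (rationalR η) (W⁻¹ * K * W) ξ u * (tensorOp N W)⁻¹) ∧
          IsLeftEigenbasis
            (fun u => tensorOp N W * opB (rationalR η) (W⁻¹ * K * W) ξ u * (tensorOp N W)⁻¹)
            (fun h => sovCov (refCov N) (fun n => opA (rationalR η) (W⁻¹ * K * W) ξ (ξ n))
              (fun n => rationalA η ξ (ξ n)) h ᵥ* (tensorOp N W)⁻¹)
            (fun h u => (W⁻¹ * K * W) 0 1 * ∏ n, (u - ξ n + ((h n : ℕ) : ℂ) * η)) ∧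
          DiagonalizableSimple
            (fun u => tensorOp N W * opB (rationalR η) (W⁻¹ * K * W) ξ u * (tensorOp N W)⁻¹) ∧
          (∀ h, sovCov (refCov N ᵥ* (tensorOp N W)⁻¹)
              (fun n => transfer (rationalR η) K ξ (ξ n)) (fun n => rationalA η ξ (ξ n)) h =
            sovCov (refCov N) (fun n => opA (rationalR η) (W⁻¹ * K * W) ξ (ξ n))
              (fun n => rationalA η ξ (ξ n)) h ᵥ* (tensorOp N W)⁻¹))) := by
  refine ⟨fun N η α ξ hη hξ => ?_, fun N η ξ hη hξ => ⟨fun K hb => ?_, fun K hK => ?_⟩⟩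
  · have hf := isSixVertexFunction_sinh
    have hg := isGeneric_sinh hη hξ
    have hK := satisfiesRTT_antidiagTwist Complex.sinh η α
    have hb : antidiagTwist α 0 1 ≠ 0 := Complex.exp_ne_zero α
    have hc : ∀ n, Complex.I * trigA η ξ (ξ n) ≠ 0 := fun n =>
      mul_ne_zero Complex.I_ne_zero (hg.prod_ne_zero n)
    have hbasis := isLeftEigenbasis_sovCov hf hg hK hb hc
    exact ⟨fun u => ⟨(monodromy_antidiagTwist _ α ξ u 0).1, (monodromy_antidiagTwist _ α ξ u 1).1,
        (monodromy_antidiagTwist _ α ξ u 0).2, (monodromy_antidiagTwist _ α ξ u 1).2⟩,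
      hg.commute_transfer hf hK, hg.commute_opA hf hK, hbasis,
      hbasis.diagonalizableSimple (eventually_injective_eigB hf hg hb),
      sovCov_transfer hf hg hK hb hc⟩
  · have hf := isSixVertexFunction_id
    have hg := isGeneric_id hη hξ
    have hc : ∀ n, rationalA η ξ (ξ n) ≠ 0 := hg.prod_ne_zero
    have hR := fun u => satisfiesRTT_id η u K
    rw [rationalR_eq]
    have hbasis := isLeftEigenbasis_sovCov hf hg hR hb hc
    exact ⟨hg.commute_transfer hf hR, hg.commute_opA hf hR, hbasis,
      hbasis.diagonalizableSimple (eventually_injective_eigB hf hg hb),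
      sovCov_transfer hf hg hR hb hc⟩
  · have hf := isSixVertexFunction_id
    have hg := isGeneric_id hη hξ
    have hc : ∀ n, rationalA η ξ (ξ n) ≠ 0 := hg.prod_ne_zero
    rw [rationalR_eq]
    refine ⟨exists_isUnit_conj_apply_ne_zero hK,
      hg.commute_transfer hf fun u => satisfiesRTT_id η u K, fun W hW hb => ?_⟩
    have hR := fun u => satisfiesRTT_id η u (W⁻¹ * K * W)
    have hT := isUnit_tensorOp (N := N) hW
    have hconj := transfer_rationalR_conj η K ξ hW
    rw [rationalR_eq] at hconj
    have hbasis := (isLeftEigenbasis_sovCov hf hg hR hb hc).conj hT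
    refine ⟨hT, hconj, hbasis,
      hbasis.diagonalizableSimple (eventually_injective_eigB hf hg hb), fun h => ?_⟩
    have hS := sovCov_transfer hf hg hR hb hc h
    rw [funext fun n => hconj (ξ n), sovCov_conj _ _ _ _ hT, hS]
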